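/- Let $\Lambda=\mathbb Z^3$, $\Lambda^\vee=\mathrm{Hom}(\Lambda,\mathbb Z)$, $V_{\mathbb C}=\mathbb C^3$; elements of $\Lambda^\vee$ are evaluated on $V_{\mathbb C}$ by linearity, and $\Lambda^\vee$ is oriented by the determinant. Let $\Lambda_{prim}$ be the set of primitive vectors of $\Lambda$. For $a\in\Lambda_{prim}$ let $H(a)=\{\alpha\in\mathbb Q^{3}=\Lambda^\vee\otimes\mathbb Q:\alpha(a)=0\}$; a basis $\alpha,\beta$ of $H(a)$ is oriented if $\det(\alpha,\beta,\delta)>0$ whenever $\delta(a)>0$. Let $U_a^+\subset V_{\mathbb C}$ be the set of $x$ such that $\mathrm{Im}(\alpha(x)\overline{\beta(x)})>0$ for some (equivalently, every) oriented basis $\alpha,\beta$ of $H(a)$. For linearly independent $a,b\in\Lambda_{prim}$ let $\gamma\in\Lambda^\vee$ be the primitive element with $\det(a,b,\cdot)=s\gamma$, $s\in\mathbb Z_{>0}$, and put $C_{+-}=\{\delta\in\Lambda^\vee:\delta(a)>0,\ \delta(b)\le 0\}$, $C_{-+}=\{\delta\in\Lambda^\vee:\delta(a)\le 0,\ \delta(b)>0\}$.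 For $w\in\mathbb C$, $x\in U_a^+\cap U_b^+$ set $$\Gamma_{a,b}(w,x)=\frac{\prod_{\delta\in C_{+-}/\mathbb Z\gamma}\bigl(1-e^{-2\pi i(\delta(x)-w)/\gamma(x)}\bigr)}{\prod_{\delta\in C_{-+}/\mathbb Z\gamma}\bigl(1-e^{2\pi i(\delta(x)-w)/\gamma(x)}\bigr)}.$$ A framing $f$ assigns to each $a\in\Lambda_{prim}$ an oriented basis $f(a)=(\alpha_1,\alpha_2,\alpha_3)$ of the $\mathbb Z$-module $\Lambda^\vee$ with $\alpha_1(a)=1$ and $\alpha_2,\alpha_3\in H(a)$. With $\theta_0(z,\tau)=\prod_{j\ge 0}(1-e^{2\pi i((j+1)\tau-z)})(1-e^{2\pi i(j\tau+z)})$ for $\mathrm{Im}\,\tau>0$, set for $\mu\in\Lambda^\vee$ $$\Delta_a(\mu;w,x)=\prod_{j=0}^{\mu(a)-1}\theta_0\Bigl(\frac{w+j\alpha_1(x)}{\alpha_3(x)},\frac{\alpha_2(x)}{\alpha_3(x)}\Bigr),$$ which for $\mu(a)<0$ means $\prod_{j=\mu(a)}^{-1}\theta_0(\cdots)^{-1}$.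 **Proposition.** Let $a,b\in\Lambda_{prim}$ be linearly independent, fix a framing, and let $\mu\in\Lambda^\vee$. Then there is a polynomial $P_{a,b}(\mu;x,w)\in\mathbb Q(x)[w]$ (depending on the framing), of degree at most $2$ in $w$ and homogeneous of degree $0$ in $(x,w)$, with coefficients regular on $U_a^+\cap U_b^+$, such that for $x\in U_a^+\cap U_b^+$ $$\frac{\Gamma_{a,b}(w+\mu(x),x)}{\Gamma_{a,b}(w,x)}=e^{\pi i P_{a,b}(\mu;x,w)}\,\frac{\Delta_a(\mu;w,x)}{\Delta_b(\mu;w,x)}$$ as meromorphic functions: for each such $x$, the set of $w$ at which none of the products defining $\Gamma_{a,b}(w,x)$, $\Gamma_{a,b}(w+\mu(x),x)$, $\Delta_a(\mu;w,x)$, $\Delta_b(\mu;w,x)$ vanishes is the complement of a closed discrete subset of $\mathbb C$, and the identity holds at every $w$ in it. -/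

import Mathlib

noncomputable section

namespace GammaWedge

open Complex Polynomial

/-- The lattice `Λ = ℤ³`. -/
abbrev Lattice3 : Type := Fin 3 → ℤ

/-- The dual lattice `Λ^∨ = Hom(Λ, ℤ)`, identified with `ℤ³` through the dual basis. -/
abbrev DualLattice3 : Type := Fin 3 → ℤ

/-- The pairing `δ(a) ∈ ℤ` of `δ ∈ Λ^∨` with `a ∈ Λ`. -/
def pair (δ : DualLattice3) (a : Lattice3) : ℤ := ∑ i, δ i * a i

/-- The value `δ(x) ∈ ℂ` of `δ ∈ Λ^∨` at `x ∈ V_ℂ = ℂ³`. -/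
def ev (δ : DualLattice3) (x : Fin 3 → ℂ) : ℂ := ∑ i, (δ i : ℂ) * x i

/-- `v` is primitive if `v ∈ k M` with `k ∈ ℤ` implies `k = ±1` (so `0` is not primitive). -/
def IsPrimitive {M : Type*} [AddCommGroup M] (v : M) : Prop :=
  ∀ k : ℤ, (∃ u : M, v = k • u) → k = 1 ∨ k = -1

/-! ### Wedges -/

/-- The linear form `det(a, b, ·) ∈ Λ^∨`. -/
def detForm (a b : Lattice3) : DualLattice3 := fun i => Matrix.det (Matrix.of ![a, b, Pi.single i 1])

/-- The modulus of the wedge `(a, b)`: the content of the form `det(a, b, ·)`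
(zero if `a`, `b` are linearly dependent). -/
def modulus (a b : Lattice3) : ℕ := Finset.univ.gcd fun i => (detForm a b i).natAbs

/-- The direction vector `γ` of the wedge `(a, b)`: the primitive element of `Λ^∨` such that
`det(a, b, ·) = s γ` with a positive integer `s`; see `directionVector_spec` and
`directionVector_unique`. -/
def directionVector (a b : Lattice3) : DualLattice3 := fun i => detForm a b i / (modulus a b : ℤ)

/-- `Λ^∨_+(a)`. -/
def posHalf (a : Lattice3) : Set DualLattice3 := {δ | 0 < pair δ a}

/-- `Λ^∨_-(a)`. -/
def negHalf (a : Lattice3) : Set DualLattice3 := {δ | pair δ a ≤ 0}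

lemma ev_add (δ ε : DualLattice3) (x : Fin 3 → ℂ) : ev (δ + ε) x = ev δ x + ev ε x := by
  simp [ev, add_mul, Finset.sum_add_distrib]

lemma ev_zsmul (n : ℤ) (δ : DualLattice3) (x : Fin 3 → ℂ) : ev (n • δ) x = n * ev δ x := by
  simp [ev, Finset.mul_sum, mul_assoc]

lemma exp_shift (s n : ℤ) (z g : ℂ) :
    exp (s * (2 * Real.pi * I * ((z + n * g) / g))) = exp (s * (2 * Real.pi * I * (z / g))) := by
  by_cases hg : g = 0
  · simp [hg]
  · rw [Complex.exp_eq_exp_iff_exists_int]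
    refine ⟨s * n, ?_⟩
    push_cast
    field_simp

/-- The factor `1 - e^{2πi s (δ(x) - w)/γ(x)}` (with `s = ±1`), which depends only on the class of
`δ` in `Λ^∨ / ℤγ`. -/
def wedgeFactor (s : ℤ) (γ : DualLattice3) (w : ℂ) (x : Fin 3 → ℂ) :
    DualLattice3 ⧸ AddSubgroup.zmultiples γ → ℂ :=
  Quotient.lift
    (fun δ : DualLattice3 => 1 - exp (s * (2 * Real.pi * I * ((ev δ x - w) / ev γ x)))) (by
      intro δ ε h
      have h' : -δ + ε ∈ AddSubgroup.zmultiples γ := QuotientAddGroup.leftRel_apply.mp h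
      obtain ⟨n, hn⟩ := AddSubgroup.mem_zmultiples_iff.mp h'
      have hε : ε = δ + n • γ := by rw [hn]; abel
      have hz : ev ε x - w = (ev δ x - w) + n * ev γ x := by
        rw [hε, ev_add, ev_zsmul]; ring
      show 1 - _ = 1 - _
      rw [hz, exp_shift])

/-- The gamma function `Γ_{a,b}(w, x)` of the wedge `(a, b)`, the quotient of the products of
`1 - e^{-2πi(δ(x) - w)/γ(x)}` over `δ ∈ C_{+-}(a,b)/ℤγ` and of
`1 - e^{2πi(δ(x) - w)/γ(x)}` over `δ ∈ C_{-+}(a,b)/ℤγ`. -/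
def gammaFun (a b : Lattice3) (w : ℂ) (x : Fin 3 → ℂ) : ℂ :=
  (∏' q : ((fun δ : DualLattice3 => (δ : DualLattice3 ⧸ AddSubgroup.zmultiples (directionVector a b))) ''
      (posHalf a ∩ negHalf b)), wedgeFactor (-1) (directionVector a b) w x q) /
  (∏' q : ((fun δ : DualLattice3 => (δ : DualLattice3 ⧸ AddSubgroup.zmultiples (directionVector a b))) ''
      (negHalf a ∩ posHalf b)), wedgeFactor 1 (directionVector a b) w x q)

/-- `(α, β)` is an oriented basis of the plane `H(a) = {α ∈ V^* | α(a) = 0}`, `V^* = ℚ³`. -/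
def IsOrientedBasis (a : Lattice3) (α β : Fin 3 → ℚ) : Prop :=
  (∑ i, α i * (a i : ℚ) = 0) ∧ (∑ i, β i * (a i : ℚ) = 0) ∧ LinearIndependent ℚ ![α, β] ∧
    ∀ δ : Fin 3 → ℚ, 0 < ∑ i, δ i * (a i : ℚ) → 0 < Matrix.det (Matrix.of ![α, β, δ])

/-- The open set `U_a^+ ⊆ V_ℂ`. -/
def domain (a : Lattice3) : Set (Fin 3 → ℂ) :=
  {x | ∃ α β : Fin 3 → ℚ, IsOrientedBasis a α β ∧
    0 < ((∑ i, (α i : ℂ) * x i) * (starRingEnd ℂ) (∑ i, (β i : ℂ) * x i)).im}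

/-! ### Theta functions and framings -/

/-- The theta function `θ_0(z, τ)`, `Im τ > 0`. -/
def theta0 (z τ : ℂ) : ℂ :=
  ∏' j : ℕ, (1 - exp (2 * Real.pi * I * ((j + 1) * τ - z))) *
    (1 - exp (2 * Real.pi * I * (j * τ + z)))

/-- A framing of `Λ_prim`: an oriented basis `(α₁, α₂, α₃)` of `Λ^∨` for each primitive `a`, such
that `α₁(a) = 1` and `α₂, α₃ ∈ H(a)`. (The indices in the code are `0, 1, 2`.) -/
structure Framing where
  basis : {a : Lattice3 // IsPrimitive a} → Module.Basis (Fin 3) ℤ DualLattice3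
  oriented : ∀ a, 0 < Matrix.det (Matrix.of fun i => basis a i)
  pair_one : ∀ a, pair (basis a 0) a = 1
  pair_two : ∀ a, pair (basis a 1) a = 0
  pair_three : ∀ a, pair (basis a 2) a = 0

/-- `Δ_a(μ; w, x)`: the product over `0 ≤ j < μ(a)` of
`θ_0((w + j α₁(x))/α₃(x), α₂(x)/α₃(x))`, where `(α₁, α₂, α₃)` is the basis assigned to `a`;
if `μ(a) < 0`, it is the inverse of the product over `μ(a) ≤ j < 0`. -/
def Delta (f : Framing) (a : {a : Lattice3 // IsPrimitive a}) (μ : DualLattice3) (w : ℂ)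
    (x : Fin 3 → ℂ) : ℂ :=
  (∏ j ∈ Finset.Ico 0 (pair μ a), theta0
    ((w + (j : ℂ) * ev (f.basis a 0) x) / ev (f.basis a 2) x)
    (ev (f.basis a 1) x / ev (f.basis a 2) x)) /
  (∏ j ∈ Finset.Ico (pair μ a) 0, theta0
    ((w + (j : ℂ) * ev (f.basis a 0) x) / ev (f.basis a 2) x)
    (ev (f.basis a 1) x / ev (f.basis a 2) x))

/-! ### Polynomials in `ℚ(x)[w]` -/

/-- The field `ℚ(x) = ℚ(x₁, x₂, x₃)`. -/
abbrev RatField : Type := FractionRing (MvPolynomial (Fin 3) ℚ)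

/-- `r ∈ ℚ(x)` is homogeneous of degree `k ∈ ℤ`. -/
def IsHomogeneousRat (r : RatField) (k : ℤ) : Prop :=
  ∃ (p q : MvPolynomial (Fin 3) ℚ) (m n : ℕ), p.IsHomogeneous m ∧ q.IsHomogeneous n ∧ q ≠ 0 ∧
    r = algebraMap _ RatField p / algebraMap _ RatField q ∧ (m : ℤ) - n = k

/-- `r ∈ ℚ(x)` is defined at `x ∈ ℂ³`: its reduced denominator does not vanish there. -/
def RegularAt (r : RatField) (x : Fin 3 → ℂ) : Prop :=
  MvPolynomial.aeval x
    (IsFractionRing.den (MvPolynomial (Fin 3) ℚ) r : MvPolynomial (Fin 3) ℚ) ≠ 0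

/-- The value of `r ∈ ℚ(x)` at `x ∈ ℂ³`, from its reduced fraction. -/
def evalRat (r : RatField) (x : Fin 3 → ℂ) : ℂ :=
  MvPolynomial.aeval x (IsFractionRing.num (MvPolynomial (Fin 3) ℚ) r) /
    MvPolynomial.aeval x
      (IsFractionRing.den (MvPolynomial (Fin 3) ℚ) r : MvPolynomial (Fin 3) ℚ)

/-- `P ∈ ℚ(x)[w]` is homogeneous of degree `0` in `(x, w)`: the coefficient of `w^i` is homogeneous
of degree `-i`. -/
def IsHomogeneousZero (P : RatField[X]) : Prop :=
  ∀ i : ℕ, IsHomogeneousRat (P.coeff i) (-(i : ℤ))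

/-- The value of `P ∈ ℚ(x)[w]` at `(x, w)`. -/
def evalPoly (P : RatField[X]) (x : Fin 3 → ℂ) (w : ℂ) : ℂ :=
  P.sum fun i c => evalRat c x * w ^ i

/-! ### The direction vector has the defining properties -/

lemma detForm_pair (a b c : Lattice3) : pair (detForm a b) c = Matrix.det (Matrix.of ![a, b, c]) := by
  simp [pair, detForm, Fin.sum_univ_three, Matrix.det_fin_three]
  ring

lemma detForm_ne_zero {a b : Lattice3} (h : LinearIndependent ℤ ![a, b]) : detForm a b ≠ 0 := by
  intro h0
  have e0 := congrFun h0 0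
  have e1 := congrFun h0 1
  have e2 := congrFun h0 2
  simp [detForm, Matrix.det_fin_three] at e0 e1 e2
  rw [LinearIndependent.pair_iff] at h
  have key : ∀ i, a i = 0 ∧ b i = 0 := by
    intro i
    have hh := h (b i) (-(a i)) (by
      ext j
      fin_cases i <;> fin_cases j <;> simp <;> linarith)
    exact ⟨by simpa using hh.2, hh.1⟩
  have h1 := h 1 0 (by ext j; simp [(key j).1])
  exact one_ne_zero h1.1

lemma modulus_pos {a b : Lattice3} (h : LinearIndependent ℤ ![a, b]) : 0 < modulus a b := by
  rcases Nat.eq_zero_or_pos (modulus a b) with h0 | h0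
  · exfalso
    apply detForm_ne_zero h
    ext i
    have := Finset.gcd_eq_zero_iff.mp h0 i (Finset.mem_univ i)
    simpa using this
  · exact h0

lemma modulus_smul (a b : Lattice3) : detForm a b = (modulus a b : ℤ) • directionVector a b := by
  ext i
  have hd : (modulus a b : ℤ) ∣ detForm a b i := by
    rw [← Int.natAbs_dvd_natAbs]
    exact Finset.gcd_dvd (f := fun i => (detForm a b i).natAbs) (Finset.mem_univ i)
  simp [directionVector, Int.mul_ediv_cancel' hd]

/-- `γ` is primitive and `det(a, b, c) = s γ(c)` with `s > 0`. -/
theorem directionVector_spec {a b : Lattice3} (h : LinearIndependent ℤ ![a, b]) :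
    IsPrimitive (directionVector a b) ∧ 0 < modulus a b ∧
      ∀ c : Lattice3, Matrix.det (Matrix.of ![a, b, c]) = modulus a b * pair (directionVector a b) c := by
  refine ⟨?_, modulus_pos h, ?_⟩
  · rintro k ⟨u, hu⟩
    have hdv : modulus a b * k.natAbs ∣ modulus a b := by
      refine Finset.dvd_gcd fun i _ => ?_
      have e := congrFun (modulus_smul a b) i
      rw [hu] at e
      simp only [Pi.smul_apply, smul_eq_mul] at e
      rw [e, Int.natAbs_mul, Int.natAbs_mul, Int.natAbs_natCast]
      exact ⟨(u i).natAbs, by ring⟩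
    have h1 : k.natAbs ∣ 1 := by
      have := modulus_pos h
      exact Nat.dvd_of_mul_dvd_mul_left this (by simpa using hdv)
    have := Nat.dvd_one.mp h1
    omega
  · intro c
    rw [← detForm_pair]
    conv_lhs => rw [modulus_smul]
    simp [pair, Finset.mul_sum, mul_assoc]

theorem directionVector_unique {a b : Lattice3} (γ : DualLattice3)
    (s : ℕ) (hγ : IsPrimitive γ) (hs : 0 < s)
    (hd : ∀ c : Lattice3, Matrix.det (Matrix.of ![a, b, c]) = s * pair γ c) : γ = directionVector a b := by
  have hform : detForm a b = (s : ℤ) • γ := by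
    ext i
    show Matrix.det (Matrix.of ![a, b, Pi.single i 1]) = _
    rw [hd]
    simp [pair, Pi.single_apply]
  have hsm : s ∣ modulus a b := by
    refine Finset.dvd_gcd fun i _ => ?_
    rw [hform]
    simp [Int.natAbs_mul]
  obtain ⟨t, ht⟩ := hsm
  have hs' : (s : ℤ) ≠ 0 := by exact_mod_cast hs.ne'
  have hγt : γ = (t : ℤ) • directionVector a b := by
    have e := modulus_smul a b
    rw [hform, ht] at e
    ext i
    have ei := congrFun e i
    simp only [Pi.smul_apply, smul_eq_mul, Nat.cast_mul, mul_assoc] at ei ⊢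
    exact mul_left_cancel₀ hs' ei
  have : (t : ℤ) = 1 ∨ (t : ℤ) = -1 := hγ t ⟨_, hγt⟩
  have ht1 : (t : ℤ) = 1 := by omega
  rw [hγt, ht1, one_smul]

end GammaWedge

end

open GammaWedge

noncomputable section

namespace GammaWedge

open Complex Polynomial

/-! ### Rational functions and their values -/

/-! Substituting `δ ↦ δ - μ` turns `Γ_{a,b}(w + μ(x), x)` into a quotient of the same factors over
shifted cones: the numerator runs over the classes with `δ(a) > -M`, `δ(b) ≤ -N`, the denominator
over those with `δ(a) ≤ -M`, `δ(b) > -N`, where `M = μ(a)`, `N = μ(b)` (`gammaFun_add_ev`). Raising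
`M` by one adds half of the row `δ(a) = -M` to the numerator and removes the other half from the
denominator, so the quotient is multiplied by the product over the whole row
(`coneRatio_succ_left`). Modulo `ℤγ` this row is a progression `δ + ℤα`, with `(α, γ)` an oriented
basis of `H(a) ∩ Λ^∨`, and its product is a theta function with `τ = α(x)/γ(x)` (`row_eq_theta0`).

The framing uses another basis of `H(a) ∩ Λ^∨`. The two differ by `SL₂(ℤ)`, under which `θ₀` changes
by `e^{πi·quadratic}` (`ThetaRel.of_cross_eq`); quasi-periodicity absorbs the change of base point
(`exists_exponent_theta0`). The inversion `τ ↦ -1/τ` is obtained from the Jacobi triple product and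
the transformation laws of `jacobiTheta₂` and `η`. The exponents are never computed: it suffices
that the class `IsExponent` of admissible ones is closed under sums, differences and `w ↦ w + δ(x)`.

Telescoping from `M = 0` to `M = μ(a)` produces `Δ_a`. Exchanging `a` and `b` replaces `γ` by `-γ`
and inverts the quotient, so the same argument for `N` produces `1/Δ_b`. All products converge
because `Im (δ(x)/γ(x)) = -p δ(a) + q δ(b)` with `p, q > 0` (`WedgeData.exists_im_div_eq`). -/

lemma RegularAt.of_div {p q : MvPolynomial (Fin 3) ℚ} {r : RatField} {x : Fin 3 → ℂ}
    (hr : r = algebraMap _ RatField p / algebraMap _ RatField q)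
    (hq : MvPolynomial.aeval x q ≠ 0) :
    RegularAt r x ∧ evalRat r x = MvPolynomial.aeval x p / MvPolynomial.aeval x q := by
  have hq0 : q ≠ 0 := by rintro rfl; simp at hq
  set n := IsFractionRing.num (MvPolynomial (Fin 3) ℚ) r with hn
  set d := IsFractionRing.den (MvPolynomial (Fin 3) ℚ) r with hd
  have hinj := IsFractionRing.injective (MvPolynomial (Fin 3) ℚ) RatField
  have hd0 : (d : MvPolynomial (Fin 3) ℚ) ≠ 0 := nonZeroDivisors.ne_zero d.2
  have e : n * q = p * d := by
    apply hinj
    have h1 : algebraMap _ RatField n / algebraMap _ RatField (d : MvPolynomial (Fin 3) ℚ) = r := by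
      have := IsFractionRing.mk'_num_den (MvPolynomial (Fin 3) ℚ) r
      rwa [IsFractionRing.mk'_eq_div] at this
    have hq' : algebraMap _ RatField q ≠ 0 := by
      rwa [Ne, map_eq_zero_iff _ hinj]
    have hd' : algebraMap _ RatField (d : MvPolynomial (Fin 3) ℚ) ≠ 0 := by
      rwa [Ne, map_eq_zero_iff _ hinj]
    rw [hr, div_eq_div_iff hd' hq'] at h1
    simpa using h1
  -- The reduced denominator is coprime to the numerator, so it divides every denominator of `r`;
  -- regularity and the value can thus be read off any fraction whose denominator is nonzero at `x`.
  have hdvd : (d : MvPolynomial (Fin 3) ℚ) ∣ q := by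
    have hrel : IsRelPrime n (d : MvPolynomial (Fin 3) ℚ) :=
      IsFractionRing.num_den_reduced (MvPolynomial (Fin 3) ℚ) r
    exact hrel.symm.dvd_of_dvd_mul_left ⟨p, by rw [e, mul_comm]⟩
  obtain ⟨k, hk⟩ := hdvd
  have hdx : MvPolynomial.aeval x (d : MvPolynomial (Fin 3) ℚ) ≠ 0 := by
    intro h0
    apply hq
    rw [hk, map_mul, h0, zero_mul]
  refine ⟨hdx, ?_⟩
  have ex := congrArg (MvPolynomial.aeval x) e
  simp only [map_mul] at ex
  show MvPolynomial.aeval x n / MvPolynomial.aeval x (d : MvPolynomial (Fin 3) ℚ) = _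
  rw [div_eq_div_iff hdx hq, ex]

lemma eq_num_div_den (r : RatField) :
    r = algebraMap _ RatField (IsFractionRing.num (MvPolynomial (Fin 3) ℚ) r) /
      algebraMap _ RatField
        (IsFractionRing.den (MvPolynomial (Fin 3) ℚ) r : MvPolynomial (Fin 3) ℚ) := by
  have := IsFractionRing.mk'_num_den (MvPolynomial (Fin 3) ℚ) r
  rw [IsFractionRing.mk'_eq_div] at this
  exact this.symm

lemma algebraMap_ratField_ne_zero {q : MvPolynomial (Fin 3) ℚ} (hq : q ≠ 0) :
    algebraMap _ RatField q ≠ 0 := by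
  rwa [Ne, map_eq_zero_iff _ (IsFractionRing.injective (MvPolynomial (Fin 3) ℚ) RatField)]

lemma RegularAt.add {r s : RatField} {x : Fin 3 → ℂ} (hr : RegularAt r x) (hs : RegularAt s x) :
    RegularAt (r + s) x ∧ evalRat (r + s) x = evalRat r x + evalRat s x := by
  have e : r + s = algebraMap _ RatField
      (IsFractionRing.num (MvPolynomial (Fin 3) ℚ) r * IsFractionRing.den (MvPolynomial (Fin 3) ℚ) s +
        IsFractionRing.den (MvPolynomial (Fin 3) ℚ) r * IsFractionRing.num (MvPolynomial (Fin 3) ℚ) s) /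
      algebraMap _ RatField (IsFractionRing.den (MvPolynomial (Fin 3) ℚ) r *
        IsFractionRing.den (MvPolynomial (Fin 3) ℚ) s : MvPolynomial (Fin 3) ℚ) := by
    conv_lhs => rw [eq_num_div_den r, eq_num_div_den s]
    rw [div_add_div _ _ (algebraMap_ratField_ne_zero (nonZeroDivisors.ne_zero (Subtype.prop _)))
      (algebraMap_ratField_ne_zero (nonZeroDivisors.ne_zero (Subtype.prop _)))]
    simp only [← map_mul, ← map_add]
  have h := RegularAt.of_div (x := x) e (by rw [map_mul]; exact mul_ne_zero hr hs)
  refine ⟨h.1, h.2.trans ?_⟩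
  simp only [map_add, map_mul]
  exact (div_add_div _ _ hr hs).symm

lemma RegularAt.mul {r s : RatField} {x : Fin 3 → ℂ} (hr : RegularAt r x) (hs : RegularAt s x) :
    RegularAt (r * s) x ∧ evalRat (r * s) x = evalRat r x * evalRat s x := by
  have e : r * s = algebraMap _ RatField
      (IsFractionRing.num (MvPolynomial (Fin 3) ℚ) r *
        IsFractionRing.num (MvPolynomial (Fin 3) ℚ) s) /
      algebraMap _ RatField (IsFractionRing.den (MvPolynomial (Fin 3) ℚ) r *
        IsFractionRing.den (MvPolynomial (Fin 3) ℚ) s : MvPolynomial (Fin 3) ℚ) := by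
    conv_lhs => rw [eq_num_div_den r, eq_num_div_den s]
    rw [div_mul_div_comm]
    simp only [← map_mul]
  have h := RegularAt.of_div (x := x) e (by rw [map_mul]; exact mul_ne_zero hr hs)
  refine ⟨h.1, h.2.trans ?_⟩
  simp only [map_mul]
  exact (div_mul_div_comm _ _ _ _).symm

lemma IsHomogeneousRat.mul {r s : RatField} {k l : ℤ} (hr : IsHomogeneousRat r k)
    (hs : IsHomogeneousRat s l) : IsHomogeneousRat (r * s) (k + l) := by
  obtain ⟨p, q, m, n, hp, hq, hq0, rfl, hk⟩ := hr
  obtain ⟨p', q', m', n', hp', hq', hq0', rfl, hl⟩ := hs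
  refine ⟨p * p', q * q', m + m', n + n', hp.mul hp', hq.mul hq', mul_ne_zero hq0 hq0', ?_, ?_⟩
  · rw [div_mul_div_comm, map_mul, map_mul]
  · push_cast; omega

lemma IsHomogeneousRat.add {r s : RatField} {k : ℤ} (hr : IsHomogeneousRat r k)
    (hs : IsHomogeneousRat s k) : IsHomogeneousRat (r + s) k := by
  obtain ⟨p, q, m, n, hp, hq, hq0, rfl, hk⟩ := hr
  obtain ⟨p', q', m', n', hp', hq', hq0', rfl, hl⟩ := hs
  refine ⟨p * q' + q * p', q * q', m + n', n + n', (hp.mul hq').add ?_, hq.mul hq',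
    mul_ne_zero hq0 hq0', ?_, ?_⟩
  · have : m + n' = n + m' := by omega
    rw [this]
    exact hq.mul hp'
  · rw [div_add_div _ _ (algebraMap_ratField_ne_zero hq0) (algebraMap_ratField_ne_zero hq0')]
    simp only [map_mul, map_add]
  · push_cast; omega

lemma isHomogeneousRat_zero (k : ℤ) : IsHomogeneousRat 0 k := by
  -- The zero polynomial is homogeneous of every degree, so only the difference `k.toNat -
  -- (-k).toNat = k` matters.
  refine ⟨0, MvPolynomial.X 0 ^ (-k).toNat, k.toNat, (-k).toNat,
    MvPolynomial.isHomogeneous_zero _ _ _, ?_, pow_ne_zero _ (MvPolynomial.X_ne_zero _), by simp,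
    by omega⟩
  simpa using (MvPolynomial.isHomogeneous_X ℚ (0 : Fin 3)).pow (-k).toNat

/-- `v` is given on `U` by a rational function, homogeneous of degree `k` and regular on `U`. -/
def IsRatFun (U : Set (Fin 3 → ℂ)) (k : ℤ) (v : (Fin 3 → ℂ) → ℂ) : Prop :=
  ∃ r : RatField, IsHomogeneousRat r k ∧ ∀ x ∈ U, RegularAt r x ∧ evalRat r x = v x

namespace IsRatFun

variable {U : Set (Fin 3 → ℂ)} {k l : ℤ} {u v : (Fin 3 → ℂ) → ℂ}

lemma of_div {p q : MvPolynomial (Fin 3) ℚ} {m n : ℕ} (hp : p.IsHomogeneous m)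
    (hq : q.IsHomogeneous n) (hq0 : q ≠ 0) (hU : ∀ x ∈ U, MvPolynomial.aeval x q ≠ 0)
    (hk : (m : ℤ) - n = k) (hv : ∀ x ∈ U, v x = MvPolynomial.aeval x p / MvPolynomial.aeval x q) :
    IsRatFun U k v :=
  ⟨algebraMap _ RatField p / algebraMap _ RatField q, ⟨p, q, m, n, hp, hq, hq0, rfl, hk⟩,
    fun x hx => ⟨(RegularAt.of_div rfl (hU x hx)).1,
      (RegularAt.of_div rfl (hU x hx)).2.trans (hv x hx).symm⟩⟩

lemma add (hu : IsRatFun U k u) (hv : IsRatFun U k v) : IsRatFun U k (fun x => u x + v x) := by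
  obtain ⟨r, hr, hr'⟩ := hu
  obtain ⟨s, hs, hs'⟩ := hv
  refine ⟨r + s, hr.add hs, fun x hx => ?_⟩
  have := (hr' x hx).1.add (hs' x hx).1
  exact ⟨this.1, by rw [this.2, (hr' x hx).2, (hs' x hx).2]⟩

lemma mul (hu : IsRatFun U k u) (hv : IsRatFun U l v) :
    IsRatFun U (k + l) (fun x => u x * v x) := by
  obtain ⟨r, hr, hr'⟩ := hu
  obtain ⟨s, hs, hs'⟩ := hv
  refine ⟨r * s, hr.mul hs, fun x hx => ?_⟩
  have := (hr' x hx).1.mul (hs' x hx).1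
  exact ⟨this.1, by rw [this.2, (hr' x hx).2, (hs' x hx).2]⟩

lemma const (c : ℚ) : IsRatFun U 0 (fun _ => (c : ℂ)) := by
  refine of_div (p := MvPolynomial.C c) (q := 1) (MvPolynomial.isHomogeneous_C _ _)
    (MvPolynomial.isHomogeneous_one _ _) one_ne_zero (by simp) (by simp) ?_
  intro x _
  simp

lemma zero (k : ℤ) : IsRatFun U k (fun _ => 0) := by
  refine ⟨0, isHomogeneousRat_zero k, fun x _ => ?_⟩
  have := RegularAt.of_div (r := 0) (p := 0) (q := 1) (x := x) (by simp) (by simp)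
  simpa using this

lemma rat_mul (c : ℚ) (hu : IsRatFun U k u) : IsRatFun U k (fun x => (c : ℂ) * u x) := by
  have := (const (U := U) c).mul hu
  rwa [zero_add] at this

/-- The linear form on `ℂ³` attached to `δ ∈ Λ^∨`, as a polynomial. -/
def linearForm (δ : DualLattice3) : MvPolynomial (Fin 3) ℚ :=
  ∑ i, MvPolynomial.C (δ i : ℚ) * MvPolynomial.X i

lemma linearForm_isHomogeneous (δ : DualLattice3) : (linearForm δ).IsHomogeneous 1 := by
  refine MvPolynomial.IsHomogeneous.sum _ _ _ fun i _ => ?_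
  simpa using (MvPolynomial.isHomogeneous_C (Fin 3) (δ i : ℚ)).mul
    (MvPolynomial.isHomogeneous_X ℚ i)

lemma aeval_linearForm (δ : DualLattice3) (x : Fin 3 → ℂ) :
    MvPolynomial.aeval x (linearForm δ) = GammaWedge.ev δ x := by
  simp [linearForm, GammaWedge.ev]

lemma ev (δ : DualLattice3) : IsRatFun U 1 (fun x => GammaWedge.ev δ x) := by
  refine of_div (p := linearForm δ) (q := 1) (linearForm_isHomogeneous δ)
    (MvPolynomial.isHomogeneous_one _ _) one_ne_zero (by simp) (by simp) ?_
  intro x _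
  simp [aeval_linearForm]

/-- Linear forms without zeros on `U` are the only denominators the exponents need. -/
lemma inv_ev {δ : DualLattice3} (hδ : δ ≠ 0) (hU : ∀ x ∈ U, GammaWedge.ev δ x ≠ 0) :
    IsRatFun U (-1) (fun x => (GammaWedge.ev δ x)⁻¹) := by
  refine of_div (p := 1) (q := linearForm δ) (MvPolynomial.isHomogeneous_one _ _)
    (linearForm_isHomogeneous δ) ?_ (by simpa only [aeval_linearForm] using hU) (by simp) ?_
  · intro h
    apply hδ
    ext i
    have := congrArg (MvPolynomial.aeval (Pi.single i (1 : ℚ))) h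
    simpa [linearForm, Pi.single_apply] using this
  · intro x _
    simp [aeval_linearForm]

end IsRatFun

/-- `φ(x, w)` is given on `U` by a polynomial of degree at most two in `w`, homogeneous of degree
`0` in `(x, w)`, whose coefficients are rational functions regular on `U`. -/
def IsExponent (U : Set (Fin 3 → ℂ)) (φ : (Fin 3 → ℂ) → ℂ → ℂ) : Prop :=
  ∃ u₀ u₁ u₂ : (Fin 3 → ℂ) → ℂ, IsRatFun U 0 u₀ ∧ IsRatFun U (-1) u₁ ∧ IsRatFun U (-2) u₂ ∧
    ∀ x ∈ U, ∀ w, φ x w = u₀ x + u₁ x * w + u₂ x * w ^ 2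

namespace IsExponent

variable {U : Set (Fin 3 → ℂ)} {φ ψ : (Fin 3 → ℂ) → ℂ → ℂ}

lemma add (hφ : IsExponent U φ) (hψ : IsExponent U ψ) :
    IsExponent U (fun x w => φ x w + ψ x w) := by
  obtain ⟨u₀, u₁, u₂, h₀, h₁, h₂, h⟩ := hφ
  obtain ⟨v₀, v₁, v₂, k₀, k₁, k₂, k⟩ := hψ
  refine ⟨_, _, _, h₀.add k₀, h₁.add k₁, h₂.add k₂, fun x hx w => ?_⟩
  simp only [h x hx, k x hx]
  ring

lemma rat_mul (c : ℚ) (hφ : IsExponent U φ) : IsExponent U (fun x w => (c : ℂ) * φ x w) := by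
  obtain ⟨u₀, u₁, u₂, h₀, h₁, h₂, h⟩ := hφ
  refine ⟨_, _, _, h₀.rat_mul c, h₁.rat_mul c, h₂.rat_mul c, fun x hx w => ?_⟩
  simp only [h x hx]
  ring

lemma congr (hφ : IsExponent U φ) (h : ∀ x ∈ U, ∀ w, ψ x w = φ x w) : IsExponent U ψ := by
  obtain ⟨u₀, u₁, u₂, h₀, h₁, h₂, h'⟩ := hφ
  exact ⟨u₀, u₁, u₂, h₀, h₁, h₂, fun x hx w => (h x hx w).trans (h' x hx w)⟩

lemma neg (hφ : IsExponent U φ) : IsExponent U (fun x w => -φ x w) :=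
  (hφ.rat_mul (-1)).congr fun x _ w => by simp

lemma sub (hφ : IsExponent U φ) (hψ : IsExponent U ψ) :
    IsExponent U (fun x w => φ x w - ψ x w) :=
  (hφ.add hψ.neg).congr fun x _ w => by ring

lemma of_ratFun {u : (Fin 3 → ℂ) → ℂ} (hu : IsRatFun U 0 u) : IsExponent U (fun x _ => u x) :=
  ⟨u, _, _, hu, .zero _, .zero _, fun x _ w => by ring⟩

lemma const (c : ℚ) : IsExponent U (fun _ _ => (c : ℂ)) := of_ratFun (.const c)

lemma ratFun_mul {u : (Fin 3 → ℂ) → ℂ} (hu : IsRatFun U (-1) u) :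
    IsExponent U (fun x w => u x * w) :=
  ⟨_, u, _, .zero _, hu, .zero _, fun x _ w => by ring⟩

lemma ratFun_mul_sq {u : (Fin 3 → ℂ) → ℂ} (hu : IsRatFun U (-2) u) :
    IsExponent U (fun x w => u x * w ^ 2) :=
  ⟨_, _, u, .zero _, .zero _, hu, fun x _ w => by ring⟩

lemma sum {ι : Type*} (s : Finset ι) {φ : ι → (Fin 3 → ℂ) → ℂ → ℂ}
    (h : ∀ i, IsExponent U (φ i)) : IsExponent U (fun x w => ∑ i ∈ s, φ i x w) := by
  classical
  induction s using Finset.induction_on with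
  | empty => simpa using IsExponent.const (U := U) 0
  | insert i s hi ih =>
    exact ((h i).add ih).congr fun x _ w => by rw [Finset.sum_insert hi]

/-- Since `δ(x)` has degree `1`, like `w`, the substitution preserves the weights `0, -1, -2` of the
coefficients. -/
lemma shift (δ : DualLattice3) (hφ : IsExponent U φ) :
    IsExponent U (fun x w => φ x (w + ev δ x)) := by
  obtain ⟨u₀, u₁, u₂, h₀, h₁, h₂, h⟩ := hφ
  have hδ : IsRatFun U 1 (fun x => ev δ x) := IsRatFun.ev δ
  refine ⟨_, _, u₂, (h₀.add (h₁.mul hδ)).add ((h₂.mul hδ).mul hδ),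
    h₁.add ((h₂.mul hδ).rat_mul 2), h₂, fun x hx w => ?_⟩
  simp only [h x hx]
  push_cast
  ring

/-- An exponent is the evaluation of an element of `ℚ(x)[w]`. -/
lemma exists_polynomial (hφ : IsExponent U φ) :
    ∃ P : RatField[X], P.degree ≤ 2 ∧ IsHomogeneousZero P ∧
      ∀ x ∈ U, (∀ i : ℕ, RegularAt (P.coeff i) x) ∧ ∀ w, evalPoly P x w = φ x w := by
  obtain ⟨u₀, u₁, u₂, ⟨r₀, h₀, h₀'⟩, ⟨r₁, h₁, h₁'⟩, ⟨r₂, h₂, h₂'⟩, h⟩ := hφ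
  have hz : ∀ x, RegularAt 0 x ∧ evalRat 0 x = 0 := fun x => by
    simpa using RegularAt.of_div (r := 0) (p := 0) (q := 1) (x := x) (by simp) (by simp)
  have hdeg : (C r₂ * X ^ 2 + C r₁ * X + C r₀ : RatField[X]).natDegree ≤ 2 :=
    natDegree_quadratic_le
  have c0 : (C r₂ * X ^ 2 + C r₁ * X + C r₀ : RatField[X]).coeff 0 = r₀ := by simp
  have c1 : (C r₂ * X ^ 2 + C r₁ * X + C r₀ : RatField[X]).coeff 1 = r₁ := by
    simp [coeff_C]
  have c2 : (C r₂ * X ^ 2 + C r₁ * X + C r₀ : RatField[X]).coeff 2 = r₂ := by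
    simp
  have c3 : ∀ i, (C r₂ * X ^ 2 + C r₁ * X + C r₀ : RatField[X]).coeff (i + 3) = 0 := fun i =>
    coeff_eq_zero_of_natDegree_lt (by omega)
  refine ⟨C r₂ * X ^ 2 + C r₁ * X + C r₀, degree_quadratic_le, ?_, fun x hx => ⟨?_, fun w => ?_⟩⟩
  · rintro (_ | _ | _ | i)
    · rw [c0]; exact h₀
    · rw [c1]; exact h₁
    · rw [c2]; exact h₂
    · rw [c3]; exact isHomogeneousRat_zero _
  · rintro (_ | _ | _ | i)
    · rw [c0]; exact (h₀' x hx).1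
    · rw [c1]; exact (h₁' x hx).1
    · rw [c2]; exact (h₂' x hx).1
    · rw [c3]; exact (hz x).1
  · rw [evalPoly, Polynomial.sum_over_range' _ (fun n => by simp [(hz x).2]) 3 (by omega)]
    simp only [Finset.sum_range_succ, Finset.sum_range_zero, c0, c1, c2, h x hx, (h₀' x hx).2,
      (h₁' x hx).2, (h₂' x hx).2]
    ring

end IsExponent

/-! ### The Jacobi triple product -/

lemma qPochhammer_ne_zero {q : ℂ} (hq : ‖q‖ < 1) (m : ℕ) :
    ∏ i ∈ Finset.range m, (1 - q ^ (i + 1)) ≠ 0 := by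
  refine Finset.prod_ne_zero_iff.mpr fun i _ h => ?_
  have h1 : ‖q ^ (i + 1)‖ < 1 := by
    rw [norm_pow]
    exact pow_lt_one₀ (norm_nonneg _) hq (by omega)
  rw [← sub_eq_zero.mp h] at h1
  simp at h1

/-- The Gauss binomial formula. -/
lemma prod_one_add_mul_pow {q : ℂ} (hq : ‖q‖ < 1) (x : ℂ) (N : ℕ) :
    ∏ j ∈ Finset.range N, (1 + x * q ^ j) =
      (∏ i ∈ Finset.range N, (1 - q ^ (i + 1))) * ∑ p ∈ Finset.HasAntidiagonal.antidiagonal N,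
        q ^ p.1.choose 2 * x ^ p.1 / ((∏ i ∈ Finset.range p.1, (1 - q ^ (i + 1))) *
          ∏ i ∈ Finset.range p.2, (1 - q ^ (i + 1))) := by
  set Q : ℕ → ℂ := fun m => ∏ i ∈ Finset.range m, (1 - q ^ (i + 1)) with hQ
  have hQ0 : ∀ m, Q m ≠ 0 := qPochhammer_ne_zero hq
  have hQs : ∀ m, Q (m + 1) = Q m * (1 - q ^ (m + 1)) := fun m => Finset.prod_range_succ _ _
  have hf : ∀ m, 1 - q ^ (m + 1) ≠ 0 := fun m h => hQ0 (m + 1) (by rw [hQs, h, mul_zero])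
  show _ = Q N * ∑ p ∈ Finset.HasAntidiagonal.antidiagonal N, q ^ p.1.choose 2 * x ^ p.1 / (Q p.1 * Q p.2)
  induction N with
  | zero => simp [hQ]
  | succ N ih =>
    rw [Finset.prod_range_succ, ih, hQs, mul_assoc, mul_assoc]
    congr 1
    -- The q-Pascal rule: `1 - q^(N+1) = (1 - q^j) + q^j (1 - q^i)` for `i + j = N + 1`. The
    -- boundary terms `j = 0` and `i = 0` vanish, and the two sums give the summands `1` and `x q^N`
    -- of the new factor.
    have split : ∀ p ∈ Finset.HasAntidiagonal.antidiagonal (N + 1),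
        (1 - q ^ (N + 1)) * (q ^ p.1.choose 2 * x ^ p.1 / (Q p.1 * Q p.2)) =
          (1 - q ^ p.2) * (q ^ p.1.choose 2 * x ^ p.1 / (Q p.1 * Q p.2)) +
          q ^ p.2 * (1 - q ^ p.1) * (q ^ p.1.choose 2 * x ^ p.1 / (Q p.1 * Q p.2)) := by
      intro p hp
      rw [← Finset.HasAntidiagonal.mem_antidiagonal.mp hp, pow_add]
      ring
    rw [Finset.mul_sum, Finset.sum_congr rfl split, Finset.sum_add_distrib,
      Finset.Nat.sum_antidiagonal_succ', Finset.Nat.sum_antidiagonal_succ]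
    simp only [pow_zero, sub_self, zero_mul, mul_zero, zero_add]
    rw [mul_add, mul_one, Finset.sum_mul]
    congr 1
    · refine Finset.sum_congr rfl fun p _ => ?_
      rw [hQs]
      have := hQ0 p.1; have := hQ0 p.2; have := hf p.2
      field_simp
    · refine Finset.sum_congr rfl fun p hp => ?_
      rw [hQs, Nat.choose_succ_succ' p.1 1, Nat.choose_one_right,
        ← Finset.HasAntidiagonal.mem_antidiagonal.mp hp]
      have := hQ0 p.1; have := hQ0 p.2; have := hf p.1
      field_simp
      ring

lemma norm_exp_two_pi_I (z : ℂ) : ‖exp (2 * Real.pi * I * z)‖ = Real.exp (-(2 * Real.pi * z.im)) := by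
  rw [Complex.norm_exp]
  simp

lemma summable_norm_exp_mul_add {τ : ℂ} (hτ : 0 < τ.im) (z : ℂ) :
    Summable fun j : ℕ => ‖exp (2 * Real.pi * I * (j * τ + z))‖ := by
  have h : ∀ j : ℕ, ‖exp (2 * Real.pi * I * (j * τ + z))‖ =
      ‖exp (2 * Real.pi * I * z)‖ * ‖exp (2 * Real.pi * I * τ)‖ ^ j := fun j => by
    rw [← norm_pow, ← norm_mul, ← Complex.exp_nat_mul, ← Complex.exp_add]
    congr 2
    ring
  simp_rw [h]
  refine (summable_geometric_of_lt_one (norm_nonneg _) ?_).mul_left _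
  rw [norm_exp_two_pi_I, Real.exp_lt_one_iff]
  have := Real.pi_pos
  have : 0 < 2 * Real.pi * τ.im := by positivity
  linarith

lemma multipliable_one_sub {ι : Type*} {v : ι → ℂ} (hv : Summable fun i => ‖v i‖) :
    Multipliable fun i => 1 - v i := by
  simp_rw [sub_eq_add_neg]
  exact multipliable_one_add_of_summable (by simpa using hv)

lemma summable_norm_exp_succ_mul_sub {τ : ℂ} (hτ : 0 < τ.im) (z : ℂ) :
    Summable fun j : ℕ => ‖exp (2 * Real.pi * I * ((j + 1) * τ - z))‖ := by
  refine (summable_norm_exp_mul_add hτ (τ - z)).congr fun j => ?_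
  congr 3
  ring

lemma theta0_eq_mul {τ : ℂ} (hτ : 0 < τ.im) (z : ℂ) :
    theta0 z τ = (∏' j : ℕ, (1 - exp (2 * Real.pi * I * ((j + 1) * τ - z)))) *
      ∏' j : ℕ, (1 - exp (2 * Real.pi * I * (j * τ + z))) :=
  (multipliable_one_sub (summable_norm_exp_succ_mul_sub hτ z)).tprod_mul
    (multipliable_one_sub (summable_norm_exp_mul_add hτ z))

/-- The monomial that comes out when `n` factors `1 - y` are turned around as `-y (1 - y⁻¹)`. -/
lemma prod_neg_exp (z τ : ℂ) (n : ℕ) :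
    ∏ i ∈ Finset.range n, (-exp (2 * Real.pi * I * ((i + 1) * τ - z))) =
      exp (Real.pi * I * n + Real.pi * I * (n * (n + 1)) * τ - 2 * Real.pi * I * n * z) := by
  induction n with
  | zero => simp
  | succ n ih =>
    rw [Finset.prod_range_succ, ih, neg_eq_neg_one_mul, ← Complex.exp_pi_mul_I, ← Complex.exp_add,
      ← Complex.exp_add]
    congr 1
    push_cast
    ring

lemma norm_qParam_lt_one {τ : ℂ} (hτ : 0 < τ.im) : ‖exp (2 * Real.pi * I * τ)‖ < 1 := by
  rw [norm_exp_two_pi_I, Real.exp_lt_one_iff]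
  have := Real.pi_pos
  have : 0 < 2 * Real.pi * τ.im := by positivity
  linarith

/-- The coefficients of the finite triple product. -/
def tripleCoeff (q : ℂ) (n : ℕ) (m : ℤ) : ℂ :=
  if m ∈ Finset.Icc (-n : ℤ) n then
    (∏ i ∈ Finset.range (2 * n), (1 - q ^ (i + 1))) /
      ((∏ i ∈ Finset.range (n + m).toNat, (1 - q ^ (i + 1))) *
        ∏ i ∈ Finset.range (n - m).toNat, (1 - q ^ (i + 1)))
  else 0

/-- After the factors with `-z` are turned around, all `2n` factors form the single product of `1 +
x q^j` with `x = -e^{2πi(z - nτ)}`, which the Gauss formula expands; the index is `m = i - n`. The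
shift `-τ/2 + 1/2` of the theta argument accounts for the sign `(-1)^m` and for `q^{m(m-1)/2}` in
place of `q^{m²/2}`. -/
lemma finite_triple_product {τ : ℂ} (hτ : 0 < τ.im) (z : ℂ) (n : ℕ) :
    ∏ j ∈ Finset.range n, (1 - exp (2 * Real.pi * I * ((j + 1) * τ - z))) *
      (1 - exp (2 * Real.pi * I * (j * τ + z))) =
    ∑' m : ℤ, tripleCoeff (exp (2 * Real.pi * I * τ)) n m *
      jacobiTheta₂_term m (z - τ / 2 + 1 / 2) τ := by
  set q := exp (2 * Real.pi * I * τ) with hqdef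
  have hq : ‖q‖ < 1 := norm_qParam_lt_one hτ
  have hpow : ∀ k : ℕ, q ^ k = exp (2 * Real.pi * I * (k * τ)) := fun k => by
    rw [hqdef, ← Complex.exp_nat_mul]; congr 1; ring
  set x := -exp (2 * Real.pi * I * (z - n * τ)) with hx
  have hprod : (∏ j ∈ Finset.range n, (1 - exp (2 * Real.pi * I * ((j + 1) * τ - z))) *
      (1 - exp (2 * Real.pi * I * (j * τ + z)))) =
      (∏ i ∈ Finset.range n, (-exp (2 * Real.pi * I * ((i + 1) * τ - z)))) *
        ∏ j ∈ Finset.range (2 * n), (1 + x * q ^ j) := by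
    rw [show 2 * n = n + n by omega, Finset.prod_range_add, Finset.prod_mul_distrib, ← mul_assoc]
    congr 1
    · rw [← Finset.prod_range_reflect (fun j => 1 + x * q ^ j), ← Finset.prod_mul_distrib]
      refine Finset.prod_congr rfl fun j hj => ?_
      have hj' : j < n := Finset.mem_range.mp hj
      have e : exp (2 * Real.pi * I * ((j + 1) * τ - z)) * (exp (2 * Real.pi * I * (z - n * τ)) *
          exp (2 * Real.pi * I * (((n : ℂ) - ((j + 1 : ℕ) : ℂ)) * τ))) = 1 := by
        rw [← Complex.exp_add, ← Complex.exp_add]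
        convert Complex.exp_zero using 2
        push_cast
        ring
      rw [hpow, hx, show n - 1 - j = n - (j + 1) by omega, Nat.cast_sub (by omega)]
      linear_combination -e
    · refine Finset.prod_congr rfl fun j _ => ?_
      rw [hpow, hx, neg_mul, ← Complex.exp_add, ← sub_eq_add_neg]
      congr 3
      push_cast
      ring
  rw [hprod, prod_one_add_mul_pow hq, prod_neg_exp, tsum_eq_sum (s := Finset.Icc (-n : ℤ) n)
    (fun m hm => by rw [tripleCoeff, if_neg hm, zero_mul]), ← mul_assoc, Finset.mul_sum]
  refine Finset.sum_bij' (fun p _ => (p.1 : ℤ) - n)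
    (fun m _ => ((n + m).toNat, (n - m).toNat)) ?_ ?_ ?_ ?_ ?_
  · intro p hp
    have := Finset.HasAntidiagonal.mem_antidiagonal.mp hp
    rw [Finset.mem_Icc]; omega
  · intro m hm
    rw [Finset.mem_Icc] at hm
    rw [Finset.HasAntidiagonal.mem_antidiagonal]; omega
  · intro p hp
    have := Finset.HasAntidiagonal.mem_antidiagonal.mp hp
    ext <;> simp; omega
  · intro m hm
    rw [Finset.mem_Icc] at hm
    simp only; omega
  · intro p hp
    have hp' := Finset.HasAntidiagonal.mem_antidiagonal.mp hp
    have hm : (p.1 : ℤ) - n ∈ Finset.Icc (-n : ℤ) n := by rw [Finset.mem_Icc]; omega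
    rw [tripleCoeff, if_pos hm, show ((n : ℤ) + (p.1 - n)).toNat = p.1 by omega,
      show ((n : ℤ) - (p.1 - n)).toNat = p.2 by omega, jacobiTheta₂_term]
    have hexp : exp (Real.pi * I * n + Real.pi * I * (n * (n + 1)) * τ - 2 * Real.pi * I * n * z) *
        (q ^ p.1.choose 2 * x ^ p.1) = exp (2 * Real.pi * I * (((p.1 : ℤ) - n : ℤ) : ℂ) *
          (z - τ / 2 + 1 / 2) + Real.pi * I * (((p.1 : ℤ) - n : ℤ) : ℂ) ^ 2 * τ) := by
      rw [hpow, hx, Nat.cast_choose_two, neg_eq_neg_one_mul, ← Complex.exp_pi_mul_I,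
        ← Complex.exp_add, ← Complex.exp_nat_mul, ← Complex.exp_add, ← Complex.exp_add,
        Complex.exp_eq_exp_iff_exists_int]
      -- The signs `(-1)^(n+i)` and `(-1)^(i-n)` agree, but the exponents chosen for them differ by
      -- `2πi n`.
      refine ⟨n, ?_⟩
      push_cast
      ring
    rw [← hexp]
    ring

open Filter Topology in
/-- The Jacobi triple product identity. -/
theorem jacobi_triple_product {τ : ℂ} (hτ : 0 < τ.im) (z : ℂ) :
    theta0 z τ * ∏' n : ℕ, (1 - exp (2 * Real.pi * I * τ) ^ (n + 1)) =
      jacobiTheta₂ (z - τ / 2 + 1 / 2) τ := by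
  set q := exp (2 * Real.pi * I * τ) with hqdef
  have hq : ‖q‖ < 1 := norm_qParam_lt_one hτ
  set Q : ℕ → ℂ := fun m => ∏ i ∈ Finset.range m, (1 - q ^ (i + 1)) with hQ
  have hQ0 : ∀ m, Q m ≠ 0 := qPochhammer_ne_zero hq
  have hsum : Summable fun n : ℕ => ‖q ^ (n + 1)‖ := by
    simp_rw [norm_pow]
    exact (summable_nat_add_iff 1).mpr (summable_geometric_of_lt_one (norm_nonneg _) hq)
  set L := ∏' n : ℕ, (1 - q ^ (n + 1)) with hL
  have hlim : Tendsto Q atTop (𝓝 L) := (multipliable_one_sub hsum).hasProd.tendsto_prod_nat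
  have hL0 : L ≠ 0 := by
    rw [hL]
    simp_rw [sub_eq_add_neg]
    refine tprod_one_add_ne_zero_of_summable (fun i h => ?_) (by simpa using hsum)
    apply hQ0 (i + 1)
    rw [hQ]
    simp only
    rw [Finset.prod_range_succ, sub_eq_add_neg, h, mul_zero]
  have hleft : Tendsto (fun n => ∏ j ∈ Finset.range n,
      (1 - exp (2 * Real.pi * I * ((j + 1) * τ - z))) * (1 - exp (2 * Real.pi * I * (j * τ + z))))
      atTop (𝓝 (theta0 z τ)) :=
    ((multipliable_one_sub (summable_norm_exp_succ_mul_sub hτ z)).mul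
      (multipliable_one_sub (summable_norm_exp_mul_add hτ z))).hasProd.tendsto_prod_nat
  -- The finite products converge to `L ≠ 0`, so they and their inverses are bounded; this bounds
  -- the coefficients uniformly in `n` and `m`, as dominated convergence requires.
  obtain ⟨B, hB⟩ := (Metric.isBounded_range_of_tendsto _ hlim).exists_norm_le
  obtain ⟨B', hB'⟩ := (Metric.isBounded_range_of_tendsto _ (hlim.inv₀ hL0)).exists_norm_le
  have hB : ∀ m, ‖Q m‖ ≤ B := fun m => hB _ ⟨m, rfl⟩
  have hB' : ∀ m, ‖(Q m)⁻¹‖ ≤ B' := fun m => hB' _ ⟨m, rfl⟩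
  have hB0 : 0 ≤ B := (norm_nonneg _).trans (hB 0)
  have hB0' : 0 ≤ B' := (norm_nonneg _).trans (hB' 0)
  have hcoeff : ∀ n m, ‖tripleCoeff q n m‖ ≤ B * (B' * B') := by
    intro n m
    rw [tripleCoeff]
    split_ifs
    · rw [div_eq_mul_inv, mul_inv, norm_mul, norm_mul]
      exact mul_le_mul (hB _) (mul_le_mul (hB' _) (hB' _) (norm_nonneg _) hB0')
        (by positivity) hB0
    · rw [norm_zero]; positivity
  -- For fixed `m` all three finite products in the coefficient tend to `L`, so the coefficient
  -- tends to `1/L`.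
  have hcl : ∀ m : ℤ, Tendsto (fun n => tripleCoeff q n m) atTop (𝓝 (L / (L * L))) := by
    intro m
    have h1 : Tendsto (fun n : ℕ => 2 * n) atTop atTop :=
      tendsto_atTop_mono (fun n => by simp only [id]; omega) tendsto_id
    have h2 : Tendsto (fun n : ℕ => ((n : ℤ) + m).toNat) atTop atTop :=
      tendsto_atTop.mpr fun b => (eventually_ge_atTop (b + m.natAbs)).mono fun n hn => by omega
    have h3 : Tendsto (fun n : ℕ => ((n : ℤ) - m).toNat) atTop atTop :=
      tendsto_atTop.mpr fun b => (eventually_ge_atTop (b + m.natAbs)).mono fun n hn => by omega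
    refine ((hlim.comp h1).div ((hlim.comp h2).mul (hlim.comp h3)) (mul_ne_zero hL0 hL0)).congr' ?_
    filter_upwards [eventually_ge_atTop m.natAbs] with n hn
    rw [tripleCoeff, if_pos (by rw [Finset.mem_Icc]; omega)]
    rfl
  have hright := tendsto_tsum_of_dominated_convergence (𝓕 := atTop)
    (f := fun n m => tripleCoeff q n m * jacobiTheta₂_term m (z - τ / 2 + 1 / 2) τ)
    (g := fun m => L / (L * L) * jacobiTheta₂_term m (z - τ / 2 + 1 / 2) τ)
    (bound := fun m => B * (B' * B') * ‖jacobiTheta₂_term m (z - τ / 2 + 1 / 2) τ‖)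
    (((summable_jacobiTheta₂_term_iff _ τ).mpr hτ).norm.mul_left _)
    (fun m => (hcl m).mul_const _)
    (Eventually.of_forall fun n m => by
      rw [norm_mul]; exact mul_le_mul_of_nonneg_right (hcoeff n m) (norm_nonneg _))
  simp_rw [hqdef, ← finite_triple_product hτ z] at hright
  have := tendsto_nhds_unique hleft hright
  rw [this, tsum_mul_left, ← jacobiTheta₂]
  field_simp

/-! ### Modularity of the theta function -/

/-- Matches the branches of the root in the laws for `η` and for `jacobiTheta₂`: `arg (-I) + arg τ`
stays in `(-π, π]` on the upper half plane, so the logarithms add. -/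
lemma inv_sqrt_I_mul_sqrt {τ : ℂ} (hτ : 0 < τ.im) :
    (sqrt I)⁻¹ * sqrt τ = (-I * τ) ^ (1 / 2 : ℂ) := by
  have hτ0 : τ ≠ 0 := by rintro rfl; simp at hτ
  have harg : arg (-I) + arg τ ∈ Set.Ioc (-Real.pi) Real.pi := by
    have h1 : 0 ≤ arg τ := Complex.arg_nonneg_iff.mpr hτ.le
    have h2 := Complex.arg_le_pi τ
    have h3 := Real.pi_pos
    rw [Complex.arg_neg_I]
    constructor <;> linarith
  rw [sqrt_eq_exp hτ0, sqrt_eq_exp I_ne_zero, Complex.cpow_def_of_ne_zero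
    (mul_ne_zero (neg_ne_zero.mpr I_ne_zero) hτ0), Complex.log_mul (neg_ne_zero.mpr I_ne_zero) hτ0
    harg, Complex.log_neg_I, Complex.log_I, ← Complex.exp_neg, ← Complex.exp_add]
  congr 1
  ring

lemma im_neg_one_div_pos {τ : ℂ} (hτ : 0 < τ.im) : 0 < (-1 / τ).im := by
  have hτ0 : τ ≠ 0 := by rintro rfl; simp at hτ
  rw [neg_div, neg_im, one_div, inv_im, neg_div, neg_neg]
  exact div_pos hτ (normSq_pos.mpr hτ0)

lemma eta_eq_exp_mul (τ : ℂ) : ModularForm.eta τ =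
    exp (Real.pi * I * (τ / 12)) * ∏' n : ℕ, (1 - exp (2 * Real.pi * I * τ) ^ (n + 1)) := by
  rw [ModularForm.eta]
  congr 1
  · rw [Function.Periodic.qParam]
    congr 1
    push_cast
    ring
  · simp only [ModularForm.eta_q_eq_pow]

/-- The Euler product is `η` without its factor `e^{πiτ/12}`; the quotient of these factors at `τ`
and `-1/τ` is the exponential that appears. -/
lemma eulerProduct_neg_one_div {τ : ℂ} (hτ : 0 < τ.im) :
    ∏' n : ℕ, (1 - exp (2 * Real.pi * I * (-1 / τ)) ^ (n + 1)) =
      (-I * τ) ^ (1 / 2 : ℂ) * exp (Real.pi * I * (τ / 12 + 1 / (12 * τ))) *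
        ∏' n : ℕ, (1 - exp (2 * Real.pi * I * τ) ^ (n + 1)) := by
  have h : ModularForm.eta (-1 / τ) = (sqrt I)⁻¹ * (sqrt τ * ModularForm.eta τ) := by
    simpa using ModularForm.eta_comp_eq_csqrt_I_inv hτ
  rw [← mul_assoc, inv_sqrt_I_mul_sqrt hτ, eta_eq_exp_mul, eta_eq_exp_mul] at h
  have e : exp (Real.pi * I * (τ / 12 + 1 / (12 * τ))) =
      exp (Real.pi * I * (τ / 12)) / exp (Real.pi * I * (-1 / τ / 12)) := by
    rw [← Complex.exp_sub]
    congr 1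
    have hτ0 : τ ≠ 0 := by rintro rfl; simp at hτ
    field_simp
    ring
  have h0 := Complex.exp_ne_zero (Real.pi * I * (-1 / τ / 12))
  apply mul_left_cancel₀ h0
  rw [h, e]
  field_simp

lemma eulerProduct_ne_zero {τ : ℂ} (hτ : 0 < τ.im) :
    ∏' n : ℕ, (1 - exp (2 * Real.pi * I * τ) ^ (n + 1)) ≠ 0 := by
  have h := ModularForm.eta_tprod_ne_zero hτ
  simpa only [ModularForm.eta_q_eq_pow] using h

/-- The behaviour of `θ₀` under `τ ↦ -1/τ`. -/
theorem theta0_neg_one_div {τ : ℂ} (hτ : 0 < τ.im) (z : ℂ) :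
    theta0 (z / τ) (-1 / τ) =
      exp (Real.pi * I * (z ^ 2 / τ - z + z / τ + τ / 6 + 1 / (6 * τ) - 1 / 2)) * theta0 z τ := by
  have hτ0 : τ ≠ 0 := by rintro rfl; simp at hτ
  have h1 := jacobi_triple_product hτ z
  have h2 := jacobi_triple_product (im_neg_one_div_pos hτ) (z / τ)
  -- The shift in the triple product is compatible with inversion up to the period `1`.
  have harg : z / τ - -1 / τ / 2 + 1 / 2 = (z - τ / 2 + 1 / 2) / τ + 1 := by
    field_simp
    ring
  rw [harg, jacobiTheta₂_add_left, eulerProduct_neg_one_div hτ] at h2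
  rw [jacobiTheta₂_functional_equation] at h1
  -- This root enters both the theta law and the Euler product law, and cancels.
  set c := (-I * τ) ^ (1 / 2 : ℂ) with hc
  have hc0 : c ≠ 0 := by
    rw [hc, Ne, Complex.cpow_eq_zero_iff]
    exact fun h => mul_ne_zero (neg_ne_zero.mpr I_ne_zero) hτ0 h.1
  set E := ∏' n : ℕ, (1 - exp (2 * Real.pi * I * τ) ^ (n + 1)) with hE
  have hE0 : E ≠ 0 := eulerProduct_ne_zero hτ
  rw [← h2] at h1
  have key : exp (Real.pi * I * (z ^ 2 / τ - z + z / τ + τ / 6 + 1 / (6 * τ) - 1 / 2)) *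
      (exp (-Real.pi * I * (z - τ / 2 + 1 / 2) ^ 2 / τ) *
        exp (Real.pi * I * (τ / 12 + 1 / (12 * τ)))) = 1 := by
    rw [← Complex.exp_add, ← Complex.exp_add]
    convert Complex.exp_zero using 2
    field_simp
    ring
  have h3 : theta0 z τ = exp (-Real.pi * I * (z - τ / 2 + 1 / 2) ^ 2 / τ) *
      exp (Real.pi * I * (τ / 12 + 1 / (12 * τ))) * theta0 (z / τ) (-1 / τ) := by
    apply mul_right_cancel₀ hE0
    rw [h1]
    field_simp
  rw [h3]
  linear_combination -theta0 (z / τ) (-1 / τ) * key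

lemma theta0_add_one_right (z τ : ℂ) : theta0 z (τ + 1) = theta0 z τ := by
  rw [theta0, theta0]
  refine tprod_congr fun j => ?_
  congr 2
  · rw [Complex.exp_eq_exp_iff_exists_int]
    exact ⟨j + 1, by push_cast; ring⟩
  · rw [Complex.exp_eq_exp_iff_exists_int]
    exact ⟨j, by push_cast; ring⟩

lemma theta0_add_one_left (z τ : ℂ) : theta0 (z + 1) τ = theta0 z τ := by
  rw [theta0, theta0]
  refine tprod_congr fun j => ?_
  congr 2
  · rw [Complex.exp_eq_exp_iff_exists_int]
    exact ⟨-1, by push_cast; ring⟩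
  · rw [Complex.exp_eq_exp_iff_exists_int]
    exact ⟨1, by push_cast; ring⟩

lemma tprod_one_sub_eq_zero_mul {v : ℕ → ℂ} (hv : Summable fun i => ‖v i‖) :
    ∏' j, (1 - v j) = (1 - v 0) * ∏' j, (1 - v (j + 1)) :=
  tprod_eq_zero_mul' (multipliable_one_sub ((summable_nat_add_iff 1).mpr hv))

/-- The shift by `τ` gives the first product a factor `1 - e^{-2πiz}` and takes `1 - e^{2πiz}` from
the second; their quotient is `-e^{-2πiz}`. -/
lemma theta0_add_tau {τ : ℂ} (hτ : 0 < τ.im) (z : ℂ) :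
    theta0 (z + τ) τ = exp (Real.pi * I * (1 - 2 * z)) * theta0 z τ := by
  rw [theta0_eq_mul hτ, theta0_eq_mul hτ]
  have h1 : ∏' j : ℕ, (1 - exp (2 * Real.pi * I * ((j + 1) * τ - (z + τ)))) =
      (1 - exp (-(2 * Real.pi * I * z))) *
        ∏' j : ℕ, (1 - exp (2 * Real.pi * I * ((j + 1) * τ - z))) := by
    refine (tprod_one_sub_eq_zero_mul (summable_norm_exp_succ_mul_sub hτ (z + τ))).trans ?_
    refine congr (congrArg (fun u v : ℂ => (1 - u) * v) (congrArg exp ?_))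
      (tprod_congr fun j => congrArg (fun u : ℂ => 1 - exp u) ?_)
    · push_cast; ring
    · push_cast; ring
  have h2 : ∏' j : ℕ, (1 - exp (2 * Real.pi * I * (j * τ + z))) =
      (1 - exp (2 * Real.pi * I * z)) *
        ∏' j : ℕ, (1 - exp (2 * Real.pi * I * (j * τ + (z + τ)))) := by
    refine (tprod_one_sub_eq_zero_mul (summable_norm_exp_mul_add hτ z)).trans ?_
    refine congr (congrArg (fun u v : ℂ => (1 - u) * v) (congrArg exp ?_))
      (tprod_congr fun j => congrArg (fun u : ℂ => 1 - exp u) ?_)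
    · push_cast; ring
    · push_cast; ring
  rw [h1, h2]
  have e1 : exp (Real.pi * I * (1 - 2 * z)) = -exp (-(2 * Real.pi * I * z)) := by
    rw [neg_eq_neg_one_mul, ← Complex.exp_pi_mul_I, ← Complex.exp_add]
    congr 1
    ring
  have e2 : exp (-(2 * Real.pi * I * z)) * exp (2 * Real.pi * I * z) = 1 := by
    rw [← Complex.exp_add, neg_add_cancel, Complex.exp_zero]
  rw [e1]
  set A := ∏' j : ℕ, (1 - exp (2 * Real.pi * I * ((j + 1) * τ - z)))
  set B := ∏' j : ℕ, (1 - exp (2 * Real.pi * I * (j * τ + (z + τ))))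
  linear_combination -A * B * e2

open Matrix

/-! ### Orientation -/

/-- The real number `a · (Im x × Re x)`, whose sign decides whether `x ∈ U_a^+`. -/
def orientedVolume (a : Lattice3) (x : Fin 3 → ℂ) : ℝ :=
  a 0 * ((x 1).im * (x 2).re - (x 2).im * (x 1).re) +
  a 1 * ((x 2).im * (x 0).re - (x 0).im * (x 2).re) +
  a 2 * ((x 0).im * (x 1).re - (x 1).im * (x 0).re)

/-- As `α` and `β` vanish on `a`, `α × β = (D/|a|²) a` with `D = det(α, β, a)`, and `D > 0` by
testing the orientation on `δ = a`. So the imaginary part defining `U_a^+` is a positive multiple of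
`a · (Im x × Re x)`. -/
lemma orientedVolume_pos {a : Lattice3} (ha0 : a ≠ 0) {x : Fin 3 → ℂ} (hx : x ∈ domain a) :
    0 < orientedVolume a x := by
  obtain ⟨α, β, ⟨hα, hβ, -, hdet⟩, him⟩ := hx
  have ha : 0 < ∑ i, (a i : ℚ) * (a i : ℚ) := by
    refine lt_of_le_of_ne (Finset.sum_nonneg fun i _ => mul_self_nonneg _) fun h0 => ?_
    have h1 := (Finset.sum_eq_zero_iff_of_nonneg fun i _ => mul_self_nonneg (a i : ℚ)).mp h0.symm
    have h2 : ∀ i, (a i : ℚ) = 0 := fun i => mul_self_eq_zero.mp (h1 i (Finset.mem_univ i))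
    exact ha0 (funext fun i => by simpa using h2 i)
  have hd := hdet (fun i => (a i : ℚ)) ha
  set D : ℚ := Matrix.det (Matrix.of ![α, β, fun i => (a i : ℚ)]) with hD
  have hDR : (0 : ℝ) < (D : ℝ) := by exact_mod_cast hd
  have haR : (0 : ℝ) < ∑ i, (a i : ℝ) * (a i : ℝ) := by exact_mod_cast ha
  have hαR : ∑ i, (α i : ℝ) * (a i : ℝ) = 0 := by exact_mod_cast hα
  have hβR : ∑ i, (β i : ℝ) * (a i : ℝ) = 0 := by exact_mod_cast hβ
  have hDe : (D : ℝ) = (α 1 * β 2 - α 2 * β 1) * a 0 + (α 2 * β 0 - α 0 * β 2) * a 1 +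
      (α 0 * β 1 - α 1 * β 0) * a 2 := by
    rw [hD]
    simp only [Matrix.det_fin_three, Matrix.of_apply, Matrix.cons_val_zero, Matrix.cons_val_one,
      Matrix.cons_val]
    push_cast
    ring
  have key : (∑ i, (a i : ℝ) * (a i : ℝ)) *
      ((∑ i, (α i : ℂ) * x i) * (starRingEnd ℂ) (∑ i, (β i : ℂ) * x i)).im =
      D * orientedVolume a x := by
    rw [hDe, orientedVolume]
    simp only [Fin.sum_univ_three] at hαR hβR ⊢
    simp only [mul_im, add_re, add_im, mul_re, ratCast_re, ratCast_im, conj_re, conj_im]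
    set u₀ := (x 1).im * (x 2).re - (x 2).im * (x 1).re with hu₀
    set u₁ := (x 2).im * (x 0).re - (x 0).im * (x 2).re with hu₁
    set u₂ := (x 0).im * (x 1).re - (x 1).im * (x 0).re with hu₂
    linear_combination ((a 1 * β 2 - a 2 * β 1) * u₀ + (a 2 * β 0 - a 0 * β 2) * u₁ +
      (a 0 * β 1 - a 1 * β 0) * u₂) * hαR - ((a 1 * α 2 - a 2 * α 1) * u₀ +
      (a 2 * α 0 - a 0 * α 2) * u₁ + (a 0 * α 1 - a 1 * α 0) * u₂) * hβR
  have h1 := mul_pos haR him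
  rw [key] at h1
  exact (pos_iff_pos_of_mul_pos h1).mp hDR

/-- The Lagrange identity for cross products. The equation `α × β = a` is the form in which oriented
bases of `H(a) ∩ Λ^∨` are used below: one positivity statement then serves all of them. -/
lemma im_ev_mul_conj {a : Lattice3} {α β : DualLattice3} (h : crossProduct α β = a)
    (x : Fin 3 → ℂ) : (ev α x * (starRingEnd ℂ) (ev β x)).im = orientedVolume a x := by
  subst h
  rw [cross_apply, orientedVolume]
  simp [ev, Fin.sum_univ_three]
  ring


lemma im_div_eq_mul_conj (u v : ℂ) : (u / v).im = (u * (starRingEnd ℂ) v).im / normSq v := by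
  rw [Complex.div_im, Complex.mul_im, Complex.conj_re, Complex.conj_im]
  ring

/-! ### Oriented lattice bases of `H(a)` -/

section OrientedPairs

variable {a : Lattice3} {α β : DualLattice3} {x : Fin 3 → ℂ}

lemma ev_left_ne_zero (h : crossProduct α β = a) (hx : 0 < orientedVolume a x) : ev α x ≠ 0 := by
  intro h0
  rw [← im_ev_mul_conj h, h0] at hx
  simp at hx

lemma ev_right_ne_zero (h : crossProduct α β = a) (hx : 0 < orientedVolume a x) : ev β x ≠ 0 := by
  intro h0
  rw [← im_ev_mul_conj h, h0] at hx
  simp at hx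

lemma im_ev_div_pos (h : crossProduct α β = a) (hx : 0 < orientedVolume a x) :
    0 < (ev α x / ev β x).im := by
  rw [im_div_eq_mul_conj, im_ev_mul_conj h]
  exact div_pos hx (normSq_pos.mpr (ev_right_ne_zero h hx))

lemma pair_left (h : crossProduct α β = a) : pair α a = 0 := by
  subst h
  simp only [pair, cross_apply, Fin.sum_univ_three]
  simp
  ring

lemma pair_right (h : crossProduct α β = a) : pair β a = 0 := by
  subst h
  simp only [pair, cross_apply, Fin.sum_univ_three]
  simp
  ring

lemma pair_add (δ ε : DualLattice3) (a : Lattice3) : pair (δ + ε) a = pair δ a + pair ε a := by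
  simp [pair, add_mul, Finset.sum_add_distrib]

lemma pair_zsmul (n : ℤ) (δ : DualLattice3) (a : Lattice3) : pair (n • δ) a = n * pair δ a := by
  simp [pair, Finset.mul_sum, mul_assoc]

lemma pair_neg (δ : DualLattice3) (a : Lattice3) : pair (-δ) a = -pair δ a := by
  simp [pair]

lemma pair_sub (δ ε : DualLattice3) (a : Lattice3) : pair (δ - ε) a = pair δ a - pair ε a := by
  rw [sub_eq_add_neg, pair_add, pair_neg, sub_eq_add_neg]

lemma ev_neg (δ : DualLattice3) (x : Fin 3 → ℂ) : ev (-δ) x = -ev δ x := by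
  simp [ev]

lemma ev_sub (δ ε : DualLattice3) (x : Fin 3 → ℂ) : ev (δ - ε) x = ev δ x - ev ε x := by
  rw [sub_eq_add_neg, ev_add, ev_neg, sub_eq_add_neg]

/-- If `α × β = a` is primitive, then `(α, β)` spans `H(a) ∩ Λ^∨`. -/
lemma exists_combination {δ₀ δ : DualLattice3} (h : crossProduct α β = a) (h₀ : pair δ₀ a = 1)
    (hδ : pair δ a = 0) : ∃ p q : ℤ, δ = p • α + q • β := by
  subst h
  simp only [pair, cross_apply, Fin.sum_univ_three] at h₀ hδ
  simp only [Matrix.cons_val_zero, Matrix.cons_val_one, Matrix.cons_val] at h₀ hδ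
  -- Cramer's rule in the basis `(α, β, δ₀)`, whose determinant is `δ₀(a) = 1`: the coefficients are
  -- `det(δ, β, δ₀)` and `det(α, δ, δ₀)`.
  refine ⟨δ 0 * (β 1 * δ₀ 2 - β 2 * δ₀ 1) + δ 1 * (β 2 * δ₀ 0 - β 0 * δ₀ 2) +
      δ 2 * (β 0 * δ₀ 1 - β 1 * δ₀ 0),
    δ 0 * (δ₀ 1 * α 2 - δ₀ 2 * α 1) + δ 1 * (δ₀ 2 * α 0 - δ₀ 0 * α 2) +
      δ 2 * (δ₀ 0 * α 1 - δ₀ 1 * α 0), ?_⟩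
  ext i
  fin_cases i
  · simp only [Fin.zero_eta, Pi.add_apply, Pi.smul_apply, smul_eq_mul]
    linear_combination δ₀ 0 * hδ - δ 0 * h₀
  · simp only [Fin.mk_one, Pi.add_apply, Pi.smul_apply, smul_eq_mul]
    linear_combination δ₀ 1 * hδ - δ 1 * h₀
  · simp only [Fin.reduceFinMk, Pi.add_apply, Pi.smul_apply, smul_eq_mul]
    linear_combination δ₀ 2 * hδ - δ 2 * h₀

lemma cross_combination (α β : DualLattice3) (p q r s : ℤ) :
    crossProduct (p • α + q • β) (r • α + s • β) = (p * s - q * r) • crossProduct α β := by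
  simp only [cross_apply]
  ext i
  fin_cases i <;> simp <;> ring

/-- The determinant of a basis is a unit, hence `1` when positive; then `α₂ × α₃` is the vector dual
to `α₁`, which is `a`. -/
lemma cross_basis (e : Module.Basis (Fin 3) ℤ DualLattice3)
    (hdet : 0 < Matrix.det (Matrix.of fun i => e i)) (h0 : pair (e 0) a = 1)
    (h1 : pair (e 1) a = 0) (h2 : pair (e 2) a = 0) : crossProduct (e 1) (e 2) = a := by
  have hu : IsUnit (Matrix.det (Matrix.of fun i => e i)) := by
    have := (Pi.basisFun ℤ (Fin 3)).isUnit_det e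
    rwa [Pi.basisFun_det_apply] at this
  have hd : Matrix.det (Matrix.of fun i => e i) = 1 := by
    rcases Int.isUnit_iff.mp hu with h | h <;> omega
  simp only [Matrix.det_fin_three, Matrix.of_apply] at hd
  simp only [pair, Fin.sum_univ_three] at h0 h1 h2
  rw [cross_apply]
  ext i
  fin_cases i
  · simp
    linear_combination a 0 * hd - (e 1 1 * e 2 2 - e 1 2 * e 2 1) * h0 -
      (e 2 1 * e 0 2 - e 2 2 * e 0 1) * h1 - (e 0 1 * e 1 2 - e 0 2 * e 1 1) * h2
  · simp
    linear_combination a 1 * hd - (e 1 2 * e 2 0 - e 1 0 * e 2 2) * h0 -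
      (e 2 2 * e 0 0 - e 2 0 * e 0 2) * h1 - (e 0 2 * e 1 0 - e 0 0 * e 1 2) * h2
  · simp
    linear_combination a 2 * hd - (e 1 0 * e 2 1 - e 1 1 * e 2 0) * h0 -
      (e 2 0 * e 0 1 - e 2 1 * e 0 0) * h1 - (e 0 0 * e 1 1 - e 0 1 * e 1 0) * h2

end OrientedPairs

/-! ### Change of basis in theta functions -/

/-- The theta functions of the pairs `(α, β)` and `(α', β')` agree on `U` up to the exponential of
a quadratic polynomial. -/
def ThetaRel (U : Set (Fin 3 → ℂ)) (α β α' β' : DualLattice3) : Prop :=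
  ∃ φ, IsExponent U φ ∧ ∀ x ∈ U, ∀ w, theta0 (w / ev β' x) (ev α' x / ev β' x) =
    exp (Real.pi * I * φ x w) * theta0 (w / ev β x) (ev α x / ev β x)

namespace ThetaRel

variable {U : Set (Fin 3 → ℂ)} {a : Lattice3} {α β α' β' α'' β'' : DualLattice3}

lemma refl : ThetaRel U α β α β :=
  ⟨_, IsExponent.const 0, fun x _ w => by simp⟩

lemma symm (h : ThetaRel U α β α' β') : ThetaRel U α' β' α β := by
  obtain ⟨φ, hφ, h⟩ := h
  refine ⟨_, hφ.neg, fun x hx w => ?_⟩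
  rw [h x hx w, ← mul_assoc, ← Complex.exp_add]
  simp

lemma trans (h : ThetaRel U α β α' β') (h' : ThetaRel U α' β' α'' β'') :
    ThetaRel U α β α'' β'' := by
  obtain ⟨φ, hφ, h⟩ := h
  obtain ⟨ψ, hψ, h'⟩ := h'
  refine ⟨_, hφ.add hψ, fun x hx w => ?_⟩
  rw [h' x hx w, h x hx w, ← mul_assoc, ← Complex.exp_add]
  congr 2
  ring

lemma translate (h : crossProduct α β = a) (hU : ∀ x ∈ U, 0 < orientedVolume a x) :
    ThetaRel U α β (α + β) β := by
  refine ⟨_, IsExponent.const 0, fun x hx w => ?_⟩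
  rw [ev_add, add_div, div_self (ev_right_ne_zero h (hU x hx)), theta0_add_one_right]
  simp

lemma isRatFun_inv_left (ha : a ≠ 0) (h : crossProduct α β = a)
    (hU : ∀ x ∈ U, 0 < orientedVolume a x) : IsRatFun U (-1) (fun x => (ev α x)⁻¹) :=
  IsRatFun.inv_ev (by rintro rfl; simp at h; exact ha h.symm) fun x hx =>
    ev_left_ne_zero h (hU x hx)

lemma isRatFun_inv_right (ha : a ≠ 0) (h : crossProduct α β = a)
    (hU : ∀ x ∈ U, 0 < orientedVolume a x) : IsRatFun U (-1) (fun x => (ev β x)⁻¹) :=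
  IsRatFun.inv_ev (by rintro rfl; simp at h; exact ha h.symm) fun x hx =>
    ev_right_ne_zero h (hU x hx)

/-- The generator `S`. With `z = w/β(x)` and `τ = α(x)/β(x)`, every term in the exponent of
`theta0_neg_one_div` is a quadratic monomial of the right weight, for instance `z²/τ =
w²/(α(x)β(x))`. -/
lemma invert (ha : a ≠ 0) (h : crossProduct α β = a) (hU : ∀ x ∈ U, 0 < orientedVolume a x) :
    ThetaRel U α β (-β) α := by
  have hα := isRatFun_inv_left ha h hU
  have hβ := isRatFun_inv_right ha h hU
  have hαβ : IsRatFun U 0 (fun x => ev α x * (ev β x)⁻¹) := by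
    simpa using (IsRatFun.ev (U := U) α).mul hβ
  have hβα : IsRatFun U 0 (fun x => ev β x * (ev α x)⁻¹) := by
    simpa using (IsRatFun.ev (U := U) β).mul hα
  refine ⟨_, (((((IsExponent.ratFun_mul_sq (hα.mul hβ)).sub (.ratFun_mul hβ)).add
    (.ratFun_mul hα)).add ((IsExponent.of_ratFun hαβ).rat_mul (1 / 6))).add
    ((IsExponent.of_ratFun hβα).rat_mul (1 / 6))).sub (.const (1 / 2)), fun x hx w => ?_⟩
  have h1 := ev_left_ne_zero h (hU x hx)
  have h2 := ev_right_ne_zero h (hU x hx)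
  have e := theta0_neg_one_div (im_ev_div_pos h (hU x hx)) (w / ev β x)
  rw [show w / ev β x / (ev α x / ev β x) = w / ev α x by field_simp,
    show -1 / (ev α x / ev β x) = ev (-β) x / ev α x by rw [ev_neg]; field_simp] at e
  rw [e]
  congr 3
  push_cast
  field_simp

/-- By transitivity and symmetry of `ThetaRel`, the generators `S` and `T` suffice. The pair `(α,
β)` is quantified inside the induction because in a product the left factor acts on the pair already
transformed by the right one. -/
lemma of_specialLinear (ha : a ≠ 0) (hU : ∀ x ∈ U, 0 < orientedVolume a x)
    (g : Matrix.SpecialLinearGroup (Fin 2) ℤ) : ∀ α β : DualLattice3, crossProduct α β = a →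
      ThetaRel U α β (g.1 0 0 • α + g.1 0 1 • β) (g.1 1 0 • α + g.1 1 1 • β) := by
  have hg : g ∈ Subgroup.closure {ModularGroup.S, ModularGroup.T} := by
    simp [SpecialLinearGroup.SL2Z_generators]
  have hcross : ∀ (g : Matrix.SpecialLinearGroup (Fin 2) ℤ) {α β : DualLattice3},
      crossProduct α β = a →
        crossProduct (g.1 0 0 • α + g.1 0 1 • β) (g.1 1 0 • α + g.1 1 1 • β) = a := by
    intro g α β h
    have := g.2
    rw [Matrix.det_fin_two] at this
    rw [cross_combination, this, h, one_smul]
  induction hg using Subgroup.closure_induction with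
  | mem g hg =>
    intro α β h
    rcases hg with rfl | hg
    · simpa [ModularGroup.S] using invert ha h hU
    · rw [Set.mem_singleton_iff] at hg
      subst hg
      simpa [ModularGroup.T] using translate h hU
  | one =>
    intro α β h
    simpa using refl
  | mul g g' _ _ ih ih' =>
    intro α β h
    refine (ih' α β h).trans ?_
    have e : ∀ i j, (g * g').1 i j = g.1 i 0 * g'.1 0 j + g.1 i 1 * g'.1 1 j := fun i j => by
      rw [Matrix.SpecialLinearGroup.coe_mul, Matrix.mul_apply, Fin.sum_univ_two]
    convert ih _ _ (hcross g' h) using 1 <;>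
    · rw [e, e]
      ext i
      simp only [Pi.add_apply, Pi.smul_apply, smul_eq_mul]
      ring
  | inv g _ ih =>
    intro α β h
    -- Applying `g` to the pair `g⁻¹(α, β)` leads back to `(α, β)`.
    have h1 := ih _ _ (hcross g⁻¹ h)
    have hd := g.2
    rw [Matrix.det_fin_two] at hd
    refine symm ?_
    have e00 : (g⁻¹).1 0 0 = g.1 1 1 := by rw [Matrix.SpecialLinearGroup.SL2_inv_expl]; rfl
    have e01 : (g⁻¹).1 0 1 = -g.1 0 1 := by rw [Matrix.SpecialLinearGroup.SL2_inv_expl]; rfl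
    have e10 : (g⁻¹).1 1 0 = -g.1 1 0 := by rw [Matrix.SpecialLinearGroup.SL2_inv_expl]; rfl
    have e11 : (g⁻¹).1 1 1 = g.1 0 0 := by rw [Matrix.SpecialLinearGroup.SL2_inv_expl]; rfl
    convert h1 using 1
    · rw [e00, e01, e10, e11]
      ext i
      simp only [Pi.add_apply, Pi.smul_apply, smul_eq_mul]
      linear_combination -α i * hd
    · rw [e00, e01, e10, e11]
      ext i
      simp only [Pi.add_apply, Pi.smul_apply, smul_eq_mul]
      linear_combination -β i * hd

/-- Any two oriented bases of `H(a) ∩ Λ^∨` give equivalent theta functions. -/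
lemma of_cross_eq {δ₀ : DualLattice3} (h₀ : pair δ₀ a = 1)
    (hU : ∀ x ∈ U, 0 < orientedVolume a x) (h : crossProduct α β = a)
    (h' : crossProduct α' β' = a) : ThetaRel U α β α' β' := by
  have ha : a ≠ 0 := by rintro rfl; simp [pair] at h₀
  obtain ⟨p, q, rfl⟩ := exists_combination h h₀ (pair_left h')
  obtain ⟨r, s, rfl⟩ := exists_combination h h₀ (pair_right h')
  have hdet : p * s - q * r = 1 := by
    rw [cross_combination, h] at h'
    obtain ⟨i, hi⟩ := Function.ne_iff.mp ha
    have e : (p * s - q * r) * a i = a i := congrFun h' i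
    exact mul_right_cancel₀ hi (e.trans (one_mul _).symm)
  exact of_specialLinear ha hU ⟨!![p, q; r, s], by rw [Matrix.det_fin_two_of, hdet]⟩ α β h

end ThetaRel

lemma theta0_add_intCast (z τ : ℂ) (n : ℤ) : theta0 (z + n) τ = theta0 z τ := by
  induction n using Int.induction_on with
  | zero => simp
  | succ n ih =>
    rw [← ih, ← theta0_add_one_left (z + (n : ℤ))]
    congr 1
    push_cast
    ring
  | pred n ih =>
    rw [← ih, ← theta0_add_one_left (z + _)]
    congr 1
    push_cast
    ring

lemma theta0_add_int_mul_tau {τ : ℂ} (hτ : 0 < τ.im) (z : ℂ) (n : ℤ) :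
    theta0 (z + n * τ) τ = exp (Real.pi * I * (n - 2 * n * z - n * (n - 1) * τ)) * theta0 z τ := by
  induction n using Int.induction_on with
  | zero => simp
  | succ n ih =>
    have e := theta0_add_tau hτ (z + (n : ℤ) * τ)
    rw [ih, ← mul_assoc, ← Complex.exp_add] at e
    rw [show z + ((n + 1 : ℤ) : ℂ) * τ = z + (n : ℤ) * τ + τ by push_cast; ring, e]
    congr 2
    push_cast
    ring
  | pred n ih =>
    have e := theta0_add_tau hτ (z + (-n - 1 : ℤ) * τ)
    rw [show z + ((-n - 1 : ℤ) : ℂ) * τ + τ = z + (-n : ℤ) * τ by push_cast; ring, ih] at e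
    apply mul_left_cancel₀ (Complex.exp_ne_zero _)
    rw [← e, ← mul_assoc, ← Complex.exp_add]
    congr 2
    push_cast
    ring

/-- The theta function of a row of the wedge, compared with the one of the framing. -/
lemma exists_exponent_theta0 {a : Lattice3} {U : Set (Fin 3 → ℂ)} {α β α₁ α₂ α₃ δ : DualLattice3}
    (hU : ∀ x ∈ U, 0 < orientedVolume a x) (h : crossProduct α β = a)
    (h' : crossProduct α₂ α₃ = a) (h₁ : pair α₁ a = 1) (j : ℤ) (hδ : pair δ a = -j) :
    ∃ φ, IsExponent U φ ∧ ∀ x ∈ U, ∀ w, theta0 ((w - ev δ x) / ev β x) (ev α x / ev β x) =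
      exp (Real.pi * I * φ x w) *
        theta0 ((w + j * ev α₁ x) / ev α₃ x) (ev α₂ x / ev α₃ x) := by
  have ha : a ≠ 0 := by rintro rfl; simp [pair] at h₁
  obtain ⟨φ, hφ, e⟩ := ThetaRel.of_cross_eq h₁ hU h' h
  -- `-δ - j α₁` vanishes on `a`, so it equals `pα + qβ`, and `(w - δ(x))/β(x)` is `(w + j
  -- α₁(x))/β(x)` plus the lattice element `pτ + q`.
  obtain ⟨p, q, hpq⟩ := exists_combination (δ := -δ - j • α₁) h h₁ (by
    rw [pair_sub, pair_neg, pair_zsmul, hδ, h₁]; ring)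
  have hβ := ThetaRel.isRatFun_inv_right ha h hU
  have hαβ : IsRatFun U 0 (fun x => ev α x * (ev β x)⁻¹) := by
    simpa using (IsRatFun.ev (U := U) α).mul hβ
  refine ⟨_, ((((IsExponent.const (p : ℚ)).sub
    ((IsExponent.ratFun_mul hβ).rat_mul (2 * p : ℚ))).sub
    ((IsExponent.of_ratFun hαβ).rat_mul (p * (p - 1) : ℚ))).add hφ).shift (j • α₁),
    fun x hx w => ?_⟩
  have h2 := ev_right_ne_zero h (hU x hx)
  have hδx : ev δ x = -(j * ev α₁ x + (p * ev α x + q * ev β x)) := by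
    have := congrArg (fun ε => ev ε x) hpq
    simp only [ev_sub, ev_neg, ev_add, ev_zsmul] at this
    linear_combination -this
  rw [show (w - ev δ x) / ev β x =
    (w + j * ev α₁ x) / ev β x + p * (ev α x / ev β x) + q by rw [hδx]; field_simp; ring,
    theta0_add_intCast, theta0_add_int_mul_tau (im_ev_div_pos h (hU x hx)), e x hx, ← mul_assoc,
    ← Complex.exp_add, ev_zsmul]
  congr 2
  push_cast
  field_simp

/-! ### Products over cones -/

/-- Auxiliary vectors for a wedge `(a, b)` with direction vector `γ`: `(α, γ)` is an oriented basis
of `H(a) ∩ Λ^∨` and `(β, -γ)` is one of `H(b) ∩ Λ^∨`. -/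
structure WedgeData (a b : Lattice3) (γ α β : DualLattice3) : Prop where
  cross_left : crossProduct α γ = a
  cross_right : crossProduct β (-γ) = b
  pos_left : 0 < pair α b
  pos_right : 0 < pair β a
  unit_left : ∃ δ, pair δ a = 1
  unit_right : ∃ δ, pair δ b = 1

namespace WedgeData

variable {a b : Lattice3} {γ α β : DualLattice3} {x : Fin 3 → ℂ}

/-- The symmetry that reduces shifts in `b` to shifts in `a`; `γ` changes sign with `det(a, b, ·)`.
-/
lemma swap (h : WedgeData a b γ α β) : WedgeData b a (-γ) β α where
  cross_left := h.cross_right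
  cross_right := by rw [neg_neg, h.cross_left]
  pos_left := h.pos_right
  pos_right := h.pos_left
  unit_left := h.unit_right
  unit_right := h.unit_left

lemma pair_dir_left (h : WedgeData a b γ α β) : pair γ a = 0 := pair_right h.cross_left

lemma pair_dir_right (h : WedgeData a b γ α β) : pair γ b = 0 := by
  have := pair_right h.cross_right
  rwa [pair_neg, neg_eq_zero] at this

lemma exists_of_pair_eq (h : WedgeData a b γ α β) {δ ε : DualLattice3}
    (hδ : pair δ a = pair ε a) : ∃ p q : ℤ, δ = ε + p • α + q • γ := by
  obtain ⟨δ₀, hδ₀⟩ := h.unit_left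
  obtain ⟨p, q, hpq⟩ := exists_combination (δ := δ - ε) h.cross_left hδ₀ (by
    rw [pair_sub, hδ, sub_self])
  exact ⟨p, q, by rw [add_assoc, ← hpq]; abel⟩

lemma pair_add_smul (h : WedgeData a b γ α β) (ε : DualLattice3) (p q : ℤ) :
    pair (ε + p • α + q • γ) b = pair ε b + p * pair α b := by
  rw [pair_add, pair_add, pair_zsmul, pair_zsmul, h.pair_dir_right, mul_zero, add_zero]

/-- A class modulo `ℤγ` is determined by its values on `a` and `b`: equality on `a` leaves `pα +
qγ`, and `α(b) ≠ 0` forces `p = 0`. -/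
lemma exists_smul_dir (h : WedgeData a b γ α β) {δ ε : DualLattice3}
    (hδ : pair δ a = pair ε a) (hδ' : pair δ b = pair ε b) : ∃ q : ℤ, δ = ε + q • γ := by
  obtain ⟨p, q, hpq⟩ := h.exists_of_pair_eq hδ
  have e := h.pair_add_smul ε p q
  rw [← hpq, hδ'] at e
  have : p = 0 := by
    have := h.pos_left
    by_contra hp
    have : p * pair α b ≠ 0 := mul_ne_zero hp this.ne'
    omega
  exact ⟨q, by rw [hpq, this, zero_smul, add_zero]⟩

/-- `Im (δ(x)/γ(x))` is negative along `C_{+-}`. -/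
lemma exists_im_div_eq (h : WedgeData a b γ α β) (ha : 0 < orientedVolume a x)
    (hb : 0 < orientedVolume b x) : ∃ p q : ℝ, 0 < p ∧ 0 < q ∧
      ∀ δ : DualLattice3, (ev δ x / ev γ x).im = -p * pair δ a + q * pair δ b := by
  have hα := im_ev_div_pos h.cross_left ha
  have hβ := im_ev_div_pos h.cross_right hb
  rw [ev_neg, div_neg, neg_im] at hβ
  have hγ := ev_right_ne_zero h.cross_left ha
  have hs : (0 : ℝ) < pair α b := by exact_mod_cast h.pos_left
  have ht : (0 : ℝ) < pair β a := by exact_mod_cast h.pos_right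
  refine ⟨-(ev β x / ev γ x).im / pair β a, (ev α x / ev γ x).im / pair α b, div_pos hβ ht,
    div_pos hα hs, fun δ => ?_⟩
  -- Modulo `ℤγ`, which does not affect the imaginary part, `α(b)β(a) δ` is a combination of `α` and
  -- `β`, because `α(a) = 0` and `β(b) = 0`.
  obtain ⟨k, hk⟩ := h.exists_smul_dir (δ := (pair α b * pair β a) • δ)
    (ε := (pair α b * pair δ a) • β + (pair β a * pair δ b) • α)
    (by simp only [pair_add, pair_zsmul, pair_left h.cross_left]; ring)
    (by simp only [pair_add, pair_zsmul, pair_left h.cross_right]; ring)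
  have e := congrArg (fun ε => (ev ε x / ev γ x).im) hk
  simp only [ev_add, ev_zsmul, add_div, mul_div_assoc, div_self hγ, mul_one, add_im] at e
  simp only [← ofReal_intCast, im_ofReal_mul, ofReal_im, add_zero] at e
  push_cast at e
  field_simp
  linear_combination e

end WedgeData

/-- The exponential in the factors of the gamma function. -/
def coneTerm (γ δ : DualLattice3) (w : ℂ) (x : Fin 3 → ℂ) : ℂ :=
  exp (-(2 * Real.pi * I * ((ev δ x - w) / ev γ x)))

/-- The classes of linear forms (with representatives `D`) with `δ(a) > -M` and `δ(b) ≤ -N`. -/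
def coneSet {ι : Type*} (a b : Lattice3) (D : ι → DualLattice3) (M N : ℤ) : Set ι :=
  {i | -M < pair (D i) a ∧ pair (D i) b ≤ -N}

/-- The boundary row `δ(a) = -M`, `δ(b) ≤ -N`. -/
def rowSet {ι : Type*} (a b : Lattice3) (D : ι → DualLattice3) (M N : ℤ) : Set ι :=
  {i | pair (D i) a = -M ∧ pair (D i) b ≤ -N}

/-- The boundary row `δ(a) > -M`, `δ(b) = -N`. -/
def colSet {ι : Type*} (a b : Lattice3) (D : ι → DualLattice3) (M N : ℤ) : Set ι :=
  {i | -M < pair (D i) a ∧ pair (D i) b = -N}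

/-- The product over a shifted cone. -/
def coneProd {ι : Type*} (γ : DualLattice3) (D : ι → DualLattice3) (S : Set ι) (w : ℂ)
    (x : Fin 3 → ℂ) : ℂ :=
  ∏' i : S, (1 - coneTerm γ (D i) w x)

/-- `D` picks one linear form for each possible pair of values on `a` and `b`. -/
def IsSection {ι : Type*} (a b : Lattice3) (D : ι → DualLattice3) : Prop :=
  ∀ δ, ∃! i, pair (D i) a = pair δ a ∧ pair (D i) b = pair δ b

lemma IsSection.swap {ι : Type*} {a b : Lattice3} {D : ι → DualLattice3} (h : IsSection a b D) :
    IsSection b a D := fun δ => by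
  simpa only [and_comm] using h δ

section Cone

variable {ι : Type*} {a b : Lattice3} {γ α β : DualLattice3} {D : ι → DualLattice3}
  {x : Fin 3 → ℂ}

lemma coneTerm_congr (h : WedgeData a b γ α β) (ha : 0 < orientedVolume a x) {δ ε : DualLattice3}
    (hδ : pair δ a = pair ε a) (hδ' : pair δ b = pair ε b) (w : ℂ) :
    coneTerm γ δ w x = coneTerm γ ε w x := by
  obtain ⟨q, rfl⟩ := h.exists_smul_dir hδ hδ'
  have hγ := ev_right_ne_zero h.cross_left ha
  rw [coneTerm, coneTerm, ev_add, ev_zsmul, Complex.exp_eq_exp_iff_exists_int]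
  refine ⟨-q, ?_⟩
  field_simp
  push_cast
  ring

lemma IsSection.injective_pair (hD : IsSection a b D) {i j : ι}
    (h : pair (D i) a = pair (D j) a) (h' : pair (D i) b = pair (D j) b) : i = j :=
  (hD (D j)).unique ⟨h, h'⟩ ⟨rfl, rfl⟩

lemma norm_coneTerm (γ δ : DualLattice3) (w : ℂ) (x : Fin 3 → ℂ) :
    ‖coneTerm γ δ w x‖ = Real.exp (2 * Real.pi * ((ev δ x - w) / ev γ x).im) := by
  have := norm_exp_two_pi_I (-((ev δ x - w) / ev γ x))
  rwa [mul_neg, neg_im, mul_neg, neg_neg] at this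

/-- The coordinates `δ(a) + M` and `-N - δ(b)` embed the cone in `ℕ × ℕ`, and the norm becomes a
constant times a product of two geometric terms. -/
lemma summable_norm_coneTerm (h : WedgeData a b γ α β) (ha : 0 < orientedVolume a x)
    (hb : 0 < orientedVolume b x) (hD : IsSection a b D) (M N : ℤ) (w : ℂ) :
    Summable fun i : coneSet a b D M N => ‖coneTerm γ (D i) w x‖ := by
  obtain ⟨p, q, hp, hq, hpq⟩ := h.exists_im_div_eq ha hb
  have hr : ∀ {t : ℝ}, 0 < t → Summable fun k : ℕ => Real.exp (-(2 * Real.pi * t)) ^ k := by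
    intro t ht
    refine summable_geometric_of_lt_one (Real.exp_pos _).le ?_
    rw [Real.exp_lt_one_iff]
    have := Real.pi_pos
    have : 0 < 2 * Real.pi * t := by positivity
    linarith
  have hsum : Summable fun k : ℕ × ℕ =>
      Real.exp (-(2 * Real.pi * p)) ^ k.1 * Real.exp (-(2 * Real.pi * q)) ^ k.2 :=
    (hr hp).mul_of_nonneg (hr hq) (fun k => by positivity) (fun k => by positivity)
  let e : coneSet a b D M N → ℕ × ℕ := fun i =>
    ((pair (D i) a + M).toNat, (-N - pair (D i) b).toNat)
  have he : Function.Injective e := by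
    rintro ⟨i, hi⟩ ⟨j, hj⟩ hij
    simp only [coneSet, Set.mem_ofPred_eq] at hi hj
    simp only [e, Prod.mk.injEq] at hij
    obtain rfl : i = j := hD.injective_pair (by omega) (by omega)
    rfl
  refine ((hsum.comp_injective he).mul_left
    (Real.exp (2 * Real.pi * (p * M - q * N - (w / ev γ x).im)))).congr fun i => ?_
  have hi := i.2
  simp only [coneSet, Set.mem_ofPred_eq] at hi
  have e1 : (((pair (D i) a + M).toNat : ℤ) : ℝ) = pair (D i) a + M := by
    rw [Int.toNat_of_nonneg (by omega)]; push_cast; ring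
  have e2 : (((-N - pair (D i) b).toNat : ℤ) : ℝ) = -N - pair (D i) b := by
    rw [Int.toNat_of_nonneg (by omega)]; push_cast; ring
  simp only [Function.comp, e]
  rw [norm_coneTerm, sub_div, sub_im, hpq, ← Real.exp_nat_mul,
    ← Real.exp_nat_mul, ← Real.exp_add, ← Real.exp_add]
  congr 1
  rw [Int.cast_natCast] at e1 e2
  rw [e1, e2]
  ring

lemma rowSet_subset (M N : ℤ) : rowSet a b D M N ⊆ coneSet a b D (M + 1) N := fun _ hi =>
  ⟨by have := hi.1; omega, hi.2⟩

lemma colSet_subset (M N : ℤ) : colSet a b D M N ⊆ coneSet a b D M N := fun _ hi =>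
  ⟨hi.1, hi.2.le⟩

lemma summable_norm_coneTerm_subset (h : WedgeData a b γ α β) (ha : 0 < orientedVolume a x)
    (hb : 0 < orientedVolume b x) (hD : IsSection a b D) {M N : ℤ} {S : Set ι}
    (hS : S ⊆ coneSet a b D M N) (w : ℂ) : Summable fun i : S => ‖coneTerm γ (D i) w x‖ := by
  have := (summable_norm_coneTerm h ha hb hD M N w).comp_injective (Set.inclusion_injective hS)
  exact this

lemma coneProd_union (h : WedgeData a b γ α β) (ha : 0 < orientedVolume a x)
    (hb : 0 < orientedVolume b x) (hD : IsSection a b D) {M N M' N' : ℤ} {S T : Set ι}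
    (hS : S ⊆ coneSet a b D M N) (hT : T ⊆ coneSet a b D M' N') (hST : Disjoint S T) (w : ℂ) :
    coneProd γ D (S ∪ T) w x = coneProd γ D S w x * coneProd γ D T w x :=
  Multipliable.tprod_union_disjoint (f := fun i => 1 - coneTerm γ (D i) w x) hST
    (multipliable_one_sub (summable_norm_coneTerm_subset h ha hb hD hS w))
    (multipliable_one_sub (summable_norm_coneTerm_subset h ha hb hD hT w))

lemma coneProd_succ_left (h : WedgeData a b γ α β) (ha : 0 < orientedVolume a x)
    (hb : 0 < orientedVolume b x) (hD : IsSection a b D) (M N : ℤ) (w : ℂ) :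
    coneProd γ D (coneSet a b D (M + 1) N) w x =
      coneProd γ D (coneSet a b D M N) w x * coneProd γ D (rowSet a b D M N) w x := by
  rw [← coneProd_union h ha hb hD subset_rfl (rowSet_subset M N)]
  · congr 1
    ext i
    simp only [coneSet, rowSet, Set.mem_union, Set.mem_ofPred_eq]
    omega
  · rw [Set.disjoint_left]
    rintro i ⟨hi, -⟩ ⟨hi', -⟩
    omega

lemma coneProd_succ_right (h : WedgeData a b γ α β) (ha : 0 < orientedVolume a x)
    (hb : 0 < orientedVolume b x) (hD : IsSection a b D) (M N : ℤ) (w : ℂ) :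
    coneProd γ D (coneSet a b D M N) w x =
      coneProd γ D (coneSet a b D M (N + 1)) w x * coneProd γ D (colSet a b D M N) w x := by
  rw [← coneProd_union h ha hb hD subset_rfl (colSet_subset M N)]
  · congr 1
    ext i
    simp only [coneSet, colSet, Set.mem_union, Set.mem_ofPred_eq]
    omega
  · rw [Set.disjoint_left]
    rintro i ⟨-, hi⟩ ⟨-, hi'⟩
    omega

/-- A product over the classes of an arithmetic progression. -/
lemma coneProd_eq_tprod (h : WedgeData a b γ α β) (ha : 0 < orientedVolume a x)
    (hD : IsSection a b D) {S : Set ι} {ε : ℕ → DualLattice3} {γ' : DualLattice3}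
    (hγ' : γ' = γ ∨ γ' = -γ) (hb : 0 < orientedVolume b x)
    (hinj : ∀ j k, pair (ε j) b = pair (ε k) b → j = k)
    (hmem : ∀ i, i ∈ S ↔ ∃ j, pair (D i) a = pair (ε j) a ∧ pair (D i) b = pair (ε j) b) (w : ℂ) :
    coneProd γ' D S w x = ∏' j, (1 - coneTerm γ' (ε j) w x) := by
  have hD' := hD
  choose idx hidx _ using hD
  have hidx : ∀ δ, pair (D (idx δ)) a = pair δ a ∧ pair (D (idx δ)) b = pair δ b := hidx
  let e : ℕ → S := fun j => ⟨idx (ε j), (hmem _).mpr ⟨j, hidx (ε j)⟩⟩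
  have he : Function.Bijective e := by
    constructor
    · intro j k hjk
      have h1 : idx (ε j) = idx (ε k) := congrArg Subtype.val hjk
      apply hinj
      rw [← (hidx (ε j)).2, h1, (hidx (ε k)).2]
    · rintro ⟨i, hi⟩
      obtain ⟨j, hj⟩ := (hmem i).mp hi
      refine ⟨j, Subtype.ext ?_⟩
      exact hD'.injective_pair ((hidx _).1.trans hj.1.symm) ((hidx _).2.trans hj.2.symm)
  rw [coneProd, ← (Equiv.ofBijective e he).tprod_eq]
  refine tprod_congr fun j => ?_
  congr 1
  rcases hγ' with rfl | rfl
  · exact coneTerm_congr h ha (hidx _).1 (hidx _).2 w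
  · exact coneTerm_congr h.swap hb (hidx _).2 (hidx _).1 w

/-- The product over a full row is a theta function. -/
lemma row_eq_theta0 (h : WedgeData a b γ α β) (hD : IsSection a b D) (M N : ℤ) :
    ∃ δ, pair δ a = -M ∧ ∀ x, 0 < orientedVolume a x → 0 < orientedVolume b x → ∀ w,
      coneProd γ D (rowSet a b D M N) w x *
      coneProd (-γ) D (colSet b a D N M) w x =
        theta0 ((w - ev δ x) / ev γ x) (ev α x / ev γ x) := by
  obtain ⟨α₁, hα₁⟩ := h.unit_left
  have hs := h.pos_left
  set s := pair α b with hs_def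
  -- `k` is a floor, so `δ` is the last form of the row with `δ(b) ≤ -N`: the forms `δ - jα`, `j ≥
  -- 0`, fill the numerator half and `δ + (j+1)α` the denominator half, giving the second and the
  -- first product of `θ₀` respectively.
  set k := (-N - pair (-M • α₁) b) / s with hk
  have hk1 : k * s ≤ -N - pair (-M • α₁) b := Int.ediv_mul_le _ hs.ne'
  have hk2 : -N - pair (-M • α₁) b < (k + 1) * s := Int.lt_ediv_add_one_mul_self _ hs
  set δ := -M • α₁ + k • α with hδ
  have hδa : pair δ a = -M := by
    rw [hδ, pair_add, pair_zsmul, pair_zsmul, hα₁, pair_left h.cross_left]; ring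
  have hδb : pair δ b = pair (-M • α₁) b + k * s := by rw [hδ, pair_add, pair_zsmul k]
  have hle : pair δ b ≤ -N := by linarith
  have hlt : -N < pair δ b + s := by linarith
  have hpa : ∀ p : ℤ, pair (δ + p • α) a = -M := fun p => by
    rw [pair_add, pair_zsmul, pair_left h.cross_left, hδa]; ring
  have hpb : ∀ p : ℤ, pair (δ + p • α) b = pair δ b + p * s := fun p => by
    rw [pair_add, pair_zsmul]
  have hex : ∀ i, pair (D i) a = -M → ∃ p : ℤ, pair (D i) b = pair δ b + p * s := fun i hi => by
    obtain ⟨p, q, hpq⟩ := h.exists_of_pair_eq (hi.trans hδa.symm)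
    exact ⟨p, by rw [hpq, h.pair_add_smul]⟩
  refine ⟨δ, hδa, fun x ha hb w => ?_⟩
  have hγ := ev_right_ne_zero h.cross_left ha
  rw [coneProd_eq_tprod (S := rowSet a b D M N) (ε := fun j : ℕ => δ + (-j : ℤ) • α) h ha hD
      (Or.inl rfl) hb ?_ ?_, coneProd_eq_tprod (S := colSet b a D N M)
      (ε := fun j : ℕ => δ + (j + 1 : ℤ) • α) h ha hD (Or.inr rfl) hb ?_ ?_,
    theta0_eq_mul (im_ev_div_pos h.cross_left ha), mul_comm]
  · congr 1
    · refine tprod_congr fun j => ?_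
      rw [coneTerm, ev_add, ev_zsmul, ev_neg]
      congr 2
      push_cast
      field_simp
      ring
    · refine tprod_congr fun j => ?_
      rw [coneTerm, ev_add, ev_zsmul]
      congr 2
      push_cast
      field_simp
      ring
  · intro j k hjk
    rw [hpb, hpb] at hjk
    have := mul_right_cancel₀ hs.ne' (add_left_cancel hjk)
    omega
  · intro i
    simp only [colSet, Set.mem_ofPred_eq, hpa, hpb]
    constructor
    · rintro ⟨hi, hi'⟩
      obtain ⟨p, hp⟩ := hex i hi'
      have hp0 : 0 < p := by
        by_contra hp0
        have : p * s ≤ 0 := mul_nonpos_of_nonpos_of_nonneg (by omega) hs.le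
        omega
      refine ⟨(p - 1).toNat, hi', ?_⟩
      rw [Int.toNat_of_nonneg (by omega), hp]
      ring
    · rintro ⟨j, hi, hi'⟩
      refine ⟨?_, hi⟩
      have : s ≤ ((j : ℤ) + 1) * s := le_mul_of_one_le_left hs.le (by omega)
      omega
  · intro j k hjk
    rw [hpb, hpb] at hjk
    have := mul_right_cancel₀ hs.ne' (add_left_cancel hjk)
    omega
  · intro i
    simp only [rowSet, Set.mem_ofPred_eq, hpa, hpb]
    constructor
    · rintro ⟨hi', hi⟩
      obtain ⟨p, hp⟩ := hex i hi'
      have hp0 : p ≤ 0 := by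
        by_contra hp0
        have : s ≤ p * s := le_mul_of_one_le_left hs.le (by omega)
        omega
      refine ⟨(-p).toNat, hi', ?_⟩
      rw [Int.toNat_of_nonneg (by omega), hp, neg_neg]
    · rintro ⟨j, hi, hi'⟩
      refine ⟨hi, ?_⟩
      have : 0 ≤ (j : ℤ) * s := mul_nonneg (by omega) hs.le
      rw [neg_mul] at hi'
      omega

/-- The gamma function with shifted cones. -/
def coneRatio (a b : Lattice3) (γ : DualLattice3) (D : ι → DualLattice3) (M N : ℤ) (w : ℂ)
    (x : Fin 3 → ℂ) : ℂ :=
  coneProd γ D (coneSet a b D M N) w x / coneProd (-γ) D (coneSet b a D N M) w x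

lemma coneRatio_swap (M N : ℤ) (w : ℂ) :
    coneRatio b a (-γ) D N M w x = (coneRatio a b γ D M N w x)⁻¹ := by
  rw [coneRatio, coneRatio, neg_neg, inv_div]

/-- Moving the boundary of the cones by one row multiplies the ratio by a theta function. -/
lemma coneRatio_succ_left (h : WedgeData a b γ α β) (ha : 0 < orientedVolume a x)
    (hb : 0 < orientedVolume b x) (hD : IsSection a b D) (M N : ℤ) (w : ℂ)
    (h0 : coneProd γ D (rowSet a b D M N) w x * coneProd (-γ) D (colSet b a D N M) w x ≠ 0) :
    coneRatio a b γ D (M + 1) N w x =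
      coneProd γ D (rowSet a b D M N) w x * coneProd (-γ) D (colSet b a D N M) w x *
        coneRatio a b γ D M N w x := by
  rw [coneRatio, coneRatio, coneProd_succ_left h ha hb hD M N w,
    coneProd_succ_right h.swap hb ha hD.swap N M w]
  -- Only the cancelled factor `E` has to be nonzero; if `F = 0`, both sides are `0`.
  have h1 := right_ne_zero_of_mul h0
  set A := coneProd γ D (coneSet a b D M N) w x
  set B := coneProd γ D (rowSet a b D M N) w x
  set E := coneProd (-γ) D (colSet b a D N M) w x
  set F := coneProd (-γ) D (coneSet b a D N (M + 1)) w x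
  rw [← mul_div_mul_right (A * B) F h1, mul_div_assoc']
  congr 1
  ring

end Cone

/-! ### Nonvanishing off a discrete set -/

open Filter Topology in
lemma eventually_codiscrete_tprod_ne_zero {ι : Type*} {v : ι → ℂ} (hv : Summable fun i => ‖v i‖)
    {c : ℂ} (hc : c ≠ 0) : ∀ᶠ w in codiscrete ℂ, ∏' i, (1 - exp (c * w) * v i) ≠ 0 := by
  rw [Filter.Eventually, mem_codiscrete]
  intro w₀
  rw [disjoint_principal_right, compl_compl]
  -- `B` bounds `‖e^{cw}‖` on the unit disc around `w₀`, so a factor can vanish there only if `‖v i‖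
  -- ≥ B⁻¹`. These are finitely many indices, each giving isolated zeros since the derivative does
  -- not vanish.
  set B : ℝ := Real.exp (‖c‖ * (‖w₀‖ + 1)) with hB
  have hB0 : 0 < B := Real.exp_pos _
  have hfin : {i | ¬ ‖v i‖ < B⁻¹}.Finite :=
    Filter.eventually_cofinite.mp (hv.tendsto_cofinite_zero.eventually_lt_const (inv_pos.mpr hB0))
  have h1 : ∀ᶠ w in 𝓝[≠] w₀, ∀ i ∈ {i | ¬ ‖v i‖ < B⁻¹}, exp (c * w) * v i ≠ 1 := by
    refine (Filter.eventually_all_finite hfin).mpr fun i _ => ?_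
    by_cases h0 : v i = 0
    · simp [h0]
    · have hd : HasDerivAt (fun w => exp (c * w) * v i) (exp (c * w₀) * (c * 1) * v i) w₀ :=
        (((hasDerivAt_id w₀).const_mul c).cexp).mul_const (v i)
      exact hd.eventually_ne (mul_ne_zero (mul_ne_zero (Complex.exp_ne_zero _) (by simpa using hc)) h0)
  have h2 : ∀ᶠ w in 𝓝[≠] w₀, w ∈ Metric.ball w₀ 1 :=
    mem_nhdsWithin_of_mem_nhds (Metric.ball_mem_nhds _ one_pos)
  filter_upwards [h1, h2] with w hw hw'
  simp_rw [sub_eq_add_neg]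
  refine tprod_one_add_ne_zero_of_summable (fun i hi => ?_) ?_
  · have e : exp (c * w) * v i = 1 := by linear_combination -hi
    by_cases hi' : ‖v i‖ < B⁻¹
    · have hn : ‖exp (c * w)‖ ≤ B := by
        refine (Complex.norm_exp_le_exp_norm _).trans (Real.exp_le_exp.mpr ?_)
        rw [norm_mul]
        refine mul_le_mul_of_nonneg_left ?_ (norm_nonneg _)
        have h3 : ‖w - w₀‖ < 1 := mem_ball_iff_norm.mp hw'
        have h4 := norm_le_norm_add_norm_sub' w w₀
        linarith
      have h5 : ‖exp (c * w) * v i‖ < 1 := by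
        rw [norm_mul]
        calc ‖exp (c * w)‖ * ‖v i‖ ≤ B * ‖v i‖ := mul_le_mul_of_nonneg_right hn (norm_nonneg _)
          _ < B * B⁻¹ := mul_lt_mul_of_pos_left hi' hB0
          _ = 1 := mul_inv_cancel₀ hB0.ne'
      rw [e, norm_one] at h5
      exact lt_irrefl _ h5
    · exact hw i hi' e
  · simp_rw [norm_neg, norm_mul]
    exact hv.mul_left _

lemma eventually_codiscrete_theta0_ne_zero {τ : ℂ} (hτ : 0 < τ.im) (d : ℂ) {g : ℂ} (hg : g ≠ 0) :
    ∀ᶠ w in Filter.codiscrete ℂ, theta0 ((w + d) / g) τ ≠ 0 := by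
  have hc : 2 * Real.pi * I / g ≠ 0 := div_ne_zero Complex.two_pi_I_ne_zero hg
  filter_upwards [eventually_codiscrete_tprod_ne_zero (summable_norm_exp_mul_add hτ (d / g)) hc,
    eventually_codiscrete_tprod_ne_zero (summable_norm_exp_succ_mul_sub hτ (d / g))
      (neg_ne_zero.mpr hc)] with w h1 h2
  rw [theta0_eq_mul hτ]
  refine mul_ne_zero ?_ ?_
  · convert h2 using 4 with j
    rw [← Complex.exp_add]
    congr 1
    field_simp
    ring
  · convert h1 using 4 with j
    rw [← Complex.exp_add]
    congr 1
    field_simp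
    ring

lemma eventually_codiscrete_coneProd_ne_zero {ι : Type*} {a b : Lattice3} {γ α β : DualLattice3}
    {D : ι → DualLattice3} {x : Fin 3 → ℂ} (h : WedgeData a b γ α β) (ha : 0 < orientedVolume a x)
    (hb : 0 < orientedVolume b x) (hD : IsSection a b D) (M N : ℤ) :
    ∀ᶠ w in Filter.codiscrete ℂ, coneProd γ D (coneSet a b D M N) w x ≠ 0 := by
  have hγ := ev_right_ne_zero h.cross_left ha
  filter_upwards [eventually_codiscrete_tprod_ne_zero (summable_norm_coneTerm h ha hb hD M N 0)
    (div_ne_zero Complex.two_pi_I_ne_zero hγ)] with w hw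
  rw [coneProd]
  convert hw using 4 with i
  rw [coneTerm, coneTerm, ← Complex.exp_add]
  congr 1
  field_simp
  ring

/-! ### Telescoping -/

/-- Both signs of `M` are treated at once and without division; the recurrence is needed only
between `0` and `M`, where the factors of `Δ` are known to be nonzero. -/
lemma telescope_int {r g : ℤ → ℂ} {M : ℤ}
    (h : ∀ k, 0 ≤ k ∧ k < M ∨ M ≤ k ∧ k < 0 → r (k + 1) = g k * r k) :
    r M * ∏ k ∈ Finset.Ico M 0, g k = (∏ k ∈ Finset.Ico 0 M, g k) * r 0 := by
  induction M using Int.induction_on with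
  | zero => simp
  | succ n ih =>
    have e : Finset.Ico (0 : ℤ) (n + 1) = insert (n : ℤ) (Finset.Ico (0 : ℤ) n) := by
      ext k; simp only [Finset.mem_Ico, Finset.mem_insert]; omega
    have ih := ih fun k hk => h k (by omega)
    rw [Finset.Ico_eq_empty (by omega), Finset.prod_empty, mul_one] at ih ⊢
    rw [e, Finset.prod_insert (by simp), h n (by omega), ih, mul_assoc]
  | pred n ih =>
    have e : Finset.Ico (-n - 1 : ℤ) 0 = insert (-n - 1 : ℤ) (Finset.Ico (-n : ℤ) 0) := by
      ext k; simp only [Finset.mem_Ico, Finset.mem_insert]; omega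
    have ih := ih fun k hk => h k (by omega)
    rw [Finset.Ico_eq_empty (a := 0) (by omega), Finset.prod_empty, one_mul] at ih ⊢
    have hs := h (-n - 1) (by omega)
    rw [sub_add_cancel] at hs
    rw [e, Finset.prod_insert (by simp), ← ih, hs]
    ring

/-- The factors of `Δ_a(μ; w, x)`. -/
def framedTheta (e : Fin 3 → DualLattice3) (k : ℤ) (w : ℂ) (x : Fin 3 → ℂ) : ℂ :=
  theta0 ((w + (k : ℂ) * ev (e 0) x) / ev (e 2) x) (ev (e 1) x / ev (e 2) x)

section Shift

variable {ι : Type*} {a b : Lattice3} {γ α β : DualLattice3} {D : ι → DualLattice3}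

lemma exists_exponent_row (h : WedgeData a b γ α β) (hD : IsSection a b D)
    {e : Fin 3 → DualLattice3} (h0 : pair (e 0) a = 1) (he : crossProduct (e 1) (e 2) = a)
    {U : Set (Fin 3 → ℂ)} (hUa : ∀ x ∈ U, 0 < orientedVolume a x)
    (hUb : ∀ x ∈ U, 0 < orientedVolume b x) (M N : ℤ) :
    ∃ φ, IsExponent U φ ∧ ∀ x ∈ U, ∀ w, coneProd γ D (rowSet a b D M N) w x *
      coneProd (-γ) D (colSet b a D N M) w x =
        exp (Real.pi * I * φ x w) * framedTheta e M w x := by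
  obtain ⟨δ, hδ, hrow⟩ := row_eq_theta0 h hD M N
  obtain ⟨φ, hφ, hθ⟩ := exists_exponent_theta0 hUa h.cross_left he h0 M hδ
  exact ⟨φ, hφ, fun x hx w => (hrow x (hUa x hx) (hUb x hx) w).trans (hθ x hx w)⟩

/-- Shifting the boundary of the cones by `M` rows. -/
lemma exists_exponent_shift (h : WedgeData a b γ α β) (hD : IsSection a b D)
    {e : Fin 3 → DualLattice3} (h0 : pair (e 0) a = 1) (he : crossProduct (e 1) (e 2) = a)
    {U : Set (Fin 3 → ℂ)} (hUa : ∀ x ∈ U, 0 < orientedVolume a x)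
    (hUb : ∀ x ∈ U, 0 < orientedVolume b x) (M N : ℤ) :
    ∃ φ, IsExponent U φ ∧ ∀ x ∈ U, ∀ w,
      (∏ k ∈ Finset.Ico 0 M, framedTheta e k w x) / (∏ k ∈ Finset.Ico M 0, framedTheta e k w x) ≠ 0 →
      coneRatio a b γ D M N w x = exp (Real.pi * I * φ x w) *
        ((∏ k ∈ Finset.Ico 0 M, framedTheta e k w x) /
          (∏ k ∈ Finset.Ico M 0, framedTheta e k w x)) * coneRatio a b γ D 0 N w x := by
  choose φ hφ hrow using fun k => exists_exponent_row h hD h0 he hUa hUb k N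
  refine ⟨_, (IsExponent.sum (Finset.Ico 0 M) hφ).sub (IsExponent.sum (Finset.Ico M 0) hφ),
    fun x hx w hne => ?_⟩
  -- A nonzero quotient has all its theta factors nonzero, so every single step across a row is
  -- legitimate.
  rw [div_ne_zero_iff, Finset.prod_ne_zero_iff, Finset.prod_ne_zero_iff] at hne
  have ht := telescope_int (M := M) (r := fun k => coneRatio a b γ D k N w x)
    (g := fun k => exp (Real.pi * I * φ k x w) * framedTheta e k w x) (fun k hk => by
      have hk0 : framedTheta e k w x ≠ 0 := by
        rcases hk with hk | hk
        · exact hne.1 k (Finset.mem_Ico.mpr hk)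
        · exact hne.2 k (Finset.mem_Ico.mpr hk)
      have := coneRatio_succ_left h (hUa x hx) (hUb x hx) hD k N w (by
        rw [hrow k x hx w]; exact mul_ne_zero (Complex.exp_ne_zero _) hk0)
      rw [this, hrow k x hx w])
  simp only [Finset.prod_mul_distrib, ← Complex.exp_sum, ← Finset.mul_sum] at ht
  have h2 : ∏ k ∈ Finset.Ico M 0, framedTheta e k w x ≠ 0 := Finset.prod_ne_zero_iff.mpr hne.2
  rw [mul_sub, Complex.exp_sub]
  have h3 := Complex.exp_ne_zero (Real.pi * I * ∑ k ∈ Finset.Ico M 0, φ k x w)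
  field_simp
  linear_combination ht

end Shift

/-! ### The gamma function of a wedge -/

section GammaFun

variable {a b : Lattice3} {γ α β : DualLattice3}

/-- Representatives of the classes modulo `ℤγ`. -/
def representative (γ : DualLattice3) (q : DualLattice3 ⧸ AddSubgroup.zmultiples γ) :
    DualLattice3 :=
  Quotient.out q

lemma exists_of_mk_eq {δ ε : DualLattice3}
    (h : (δ : DualLattice3 ⧸ AddSubgroup.zmultiples γ) = ε) : ∃ n : ℤ, δ = ε + n • γ := by
  obtain ⟨n, hn⟩ := AddSubgroup.mem_zmultiples_iff.mp (QuotientAddGroup.eq.mp h.symm)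
  exact ⟨n, by rw [hn]; abel⟩

lemma WedgeData.pair_eq_of_mk_eq (h : WedgeData a b γ α β) {δ ε : DualLattice3}
    (he : (δ : DualLattice3 ⧸ AddSubgroup.zmultiples γ) = ε) :
    pair δ a = pair ε a ∧ pair δ b = pair ε b := by
  obtain ⟨n, rfl⟩ := exists_of_mk_eq he
  simp only [pair_add, pair_zsmul, h.pair_dir_left, h.pair_dir_right, mul_zero, add_zero, and_self]

lemma WedgeData.pair_representative (h : WedgeData a b γ α β) (δ : DualLattice3) :
    pair (representative γ (δ : DualLattice3 ⧸ AddSubgroup.zmultiples γ)) a = pair δ a ∧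
      pair (representative γ (δ : DualLattice3 ⧸ AddSubgroup.zmultiples γ)) b = pair δ b :=
  h.pair_eq_of_mk_eq (Quotient.out_eq _)

lemma WedgeData.isSection (h : WedgeData a b γ α β) : IsSection a b (representative γ) := by
  intro δ
  refine ⟨δ, h.pair_representative δ, fun q hq => ?_⟩
  obtain ⟨n, hn⟩ := h.exists_smul_dir hq.1 hq.2
  have hq' : ((representative γ q : DualLattice3) : DualLattice3 ⧸ AddSubgroup.zmultiples γ) = q :=
    Quotient.out_eq q
  rw [← hq', hn, QuotientAddGroup.eq]
  exact AddSubgroup.mem_zmultiples_iff.mpr ⟨-n, by rw [neg_smul]; abel⟩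

/-- Translation by `-μ` on `Λ^∨ / ℤγ` is a bijection that trades the shift of `w` for a shift of the
cone. -/
lemma tprod_wedgeFactor_eq {s : ℤ} {γ' μ : DualLattice3} {C : Set DualLattice3}
    {T : Set (DualLattice3 ⧸ AddSubgroup.zmultiples γ)} {w : ℂ} {x : Fin 3 → ℂ}
    (hC : ∀ δ : DualLattice3, (δ : DualLattice3 ⧸ AddSubgroup.zmultiples γ) ∈
      (fun δ : DualLattice3 => (δ : DualLattice3 ⧸ AddSubgroup.zmultiples γ)) '' C ↔
        ((δ - μ : DualLattice3) : DualLattice3 ⧸ AddSubgroup.zmultiples γ) ∈ T)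
    (hs : ∀ δ : DualLattice3, wedgeFactor s γ (w + ev μ x) x δ = 1 - coneTerm γ'
      (representative γ ((δ - μ : DualLattice3) : DualLattice3 ⧸ AddSubgroup.zmultiples γ)) w x) :
    ∏' q : ((fun δ : DualLattice3 => (δ : DualLattice3 ⧸ AddSubgroup.zmultiples γ)) '' C),
      wedgeFactor s γ (w + ev μ x) x q = coneProd γ' (representative γ) T w x := by
  let e : ((fun δ : DualLattice3 => (δ : DualLattice3 ⧸ AddSubgroup.zmultiples γ)) '' C) ≃ T :=
    (Equiv.subRight (μ : DualLattice3 ⧸ AddSubgroup.zmultiples γ)).subtypeEquiv fun q => by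
      induction q using QuotientAddGroup.induction_on with
      | H δ => exact hC δ
  rw [coneProd, ← e.tprod_eq]
  refine tprod_congr fun q => ?_
  obtain ⟨q, hq⟩ := q
  induction q using QuotientAddGroup.induction_on with
  | H δ => exact hs δ

lemma WedgeData.mk_mem_image_iff (h : WedgeData a b γ α β) {C : Set DualLattice3}
    {P : ℤ → ℤ → Prop} (hC : ∀ δ, δ ∈ C ↔ P (pair δ a) (pair δ b)) (δ : DualLattice3) :
    (δ : DualLattice3 ⧸ AddSubgroup.zmultiples γ) ∈
      (fun δ : DualLattice3 => (δ : DualLattice3 ⧸ AddSubgroup.zmultiples γ)) '' C ↔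
        P (pair δ a) (pair δ b) := by
  constructor
  · rintro ⟨ε, hε, he⟩
    have := h.pair_eq_of_mk_eq he
    rw [← this.1, ← this.2]
    exact (hC ε).mp hε
  · intro hδ
    exact ⟨δ, (hC δ).mpr hδ, rfl⟩

lemma gammaFun_add_ev (h : WedgeData a b (directionVector a b) α β) {x : Fin 3 → ℂ}
    (ha : 0 < orientedVolume a x) (hb : 0 < orientedVolume b x) (μ : DualLattice3) (w : ℂ) :
    gammaFun a b (w + ev μ x) x = coneRatio a b (directionVector a b)
      (representative (directionVector a b)) (pair μ a) (pair μ b) w x := by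
  rw [gammaFun, coneRatio]
  congr 1
  · refine tprod_wedgeFactor_eq (fun δ => ?_) fun δ => ?_
    · rw [h.mk_mem_image_iff (C := posHalf a ∩ negHalf b) (P := fun m n => 0 < m ∧ n ≤ 0)
        (fun δ => Iff.rfl)]
      simp only [coneSet, Set.mem_ofPred_eq, h.pair_representative, pair_sub]
      omega
    · rw [coneTerm_congr h ha (h.pair_representative _).1 (h.pair_representative _).2]
      show 1 - exp _ = 1 - exp _
      rw [ev_sub]
      congr 2
      push_cast
      ring
  · refine tprod_wedgeFactor_eq (fun δ => ?_) fun δ => ?_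
    · rw [h.mk_mem_image_iff (C := negHalf a ∩ posHalf b) (P := fun m n => m ≤ 0 ∧ 0 < n)
        (fun δ => Iff.rfl)]
      simp only [coneSet, Set.mem_ofPred_eq, h.pair_representative, pair_sub]
      omega
    · rw [coneTerm_congr h.swap hb (h.pair_representative _).2 (h.pair_representative _).1]
      show 1 - exp _ = 1 - exp _
      rw [ev_sub, ev_neg]
      congr 2
      push_cast
      ring

end GammaFun

/-! ### Auxiliary vectors of a wedge -/

lemma IsPrimitive.neg {γ : DualLattice3} (hγ : IsPrimitive γ) : IsPrimitive (-γ) := by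
  rintro k ⟨u, hu⟩
  exact hγ k ⟨-u, by rw [smul_neg, ← hu, neg_neg]⟩

/-- `γ` lies in `H(a)`, and its coordinates `p, q` in the given basis are coprime because it is
primitive, so Bézout coefficients give `α` with `α × γ = a`. Then `s γ = a × b = (α × γ) × b = α(b)
γ` since `γ(b) = 0`, whence `α(b) = s > 0`. -/
lemma exists_cross_eq {a b : Lattice3} {γ : DualLattice3} {e : Fin 3 → DualLattice3} {s : ℤ}
    (h0 : pair (e 0) a = 1) (he : crossProduct (e 1) (e 2) = a) (hγ : IsPrimitive γ) (hs : 0 < s)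
    (hab : crossProduct a b = s • γ) : ∃ α, crossProduct α γ = a ∧ 0 < pair α b := by
  have horth : ∀ c : Lattice3, pair (crossProduct a b) c = a 1 * b 2 * c 0 - a 2 * b 1 * c 0 +
      (a 2 * b 0 * c 1 - a 0 * b 2 * c 1) + (a 0 * b 1 * c 2 - a 1 * b 0 * c 2) := fun c => by
    simp only [pair, cross_apply, Fin.sum_univ_three, Matrix.cons_val_zero, Matrix.cons_val_one,
      Matrix.cons_val]
    ring
  have hγa : pair γ a = 0 := by
    have := horth a
    rw [hab, pair_zsmul] at this
    have h2 : s * pair γ a = 0 := by rw [this]; ring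
    exact (mul_eq_zero.mp h2).resolve_left hs.ne'
  have hγb : pair γ b = 0 := by
    have := horth b
    rw [hab, pair_zsmul] at this
    have h2 : s * pair γ b = 0 := by rw [this]; ring
    exact (mul_eq_zero.mp h2).resolve_left hs.ne'
  obtain ⟨p, q, hpq⟩ := exists_combination he h0 hγa
  have hgcd : (Int.gcd p q : ℤ) = 1 := by
    obtain ⟨p', hp'⟩ := Int.gcd_dvd_left p q
    obtain ⟨q', hq'⟩ := Int.gcd_dvd_right p q
    have := hγ (Int.gcd p q) ⟨p' • e 1 + q' • e 2, by
      rw [smul_add, smul_smul, smul_smul, ← hp', ← hq', hpq]⟩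
    omega
  have hbez : (1 : ℤ) = p * Int.gcdA p q + q * Int.gcdB p q := by
    rw [← Int.gcd_eq_gcd_ab, hgcd]
  set α := Int.gcdB p q • e 1 + (-Int.gcdA p q) • e 2 with hα
  have hcross : crossProduct α γ = a := by
    rw [hpq, hα, cross_combination, he]
    rw [show Int.gcdB p q * q - -Int.gcdA p q * p = 1 by rw [hbez]; ring, one_smul]
  refine ⟨α, hcross, ?_⟩
  have htriple : crossProduct a b = pair α b • γ := by
    have : crossProduct (crossProduct α γ) b = pair α b • γ - pair γ b • α := by
      simp only [pair, cross_apply, Fin.sum_univ_three]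
      ext i
      fin_cases i <;> simp <;> ring
    rw [hcross, hγb, zero_smul, sub_zero] at this
    exact this
  rw [hab] at htriple
  have hγ0 : γ ≠ 0 := by
    rintro rfl
    have := hγ 0 ⟨0, by simp⟩
    omega
  obtain ⟨i, hi⟩ := Function.ne_iff.mp hγ0
  have hi' : s * γ i = pair α b * γ i := congrFun htriple i
  rw [← mul_right_cancel₀ hi hi']
  exact hs

lemma cross_eq_detForm (a b : Lattice3) : crossProduct a b = detForm a b := by
  rw [cross_apply]
  ext i
  fin_cases i <;> simp [detForm, Matrix.det_fin_three]
  ring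

lemma Framing.cross_basis (f : Framing) (a : {a : Lattice3 // IsPrimitive a}) :
    crossProduct (f.basis a 1) (f.basis a 2) = (a : Lattice3) :=
  GammaWedge.cross_basis (f.basis a) (f.oriented a) (f.pair_one a) (f.pair_two a) (f.pair_three a)

lemma exists_wedgeData (f : Framing) (a b : {a : Lattice3 // IsPrimitive a})
    (hab : LinearIndependent ℤ ![(a : Lattice3), (b : Lattice3)]) :
    ∃ α β, WedgeData (a : Lattice3) b (directionVector a b) α β := by
  have hs : (0 : ℤ) < modulus a b := by exact_mod_cast modulus_pos hab
  have hγ := (directionVector_spec hab).1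
  have e1 : crossProduct (a : Lattice3) b = (modulus a b : ℤ) • directionVector a b := by
    rw [cross_eq_detForm, modulus_smul]
  have e2 : crossProduct (b : Lattice3) a = (modulus a b : ℤ) • -directionVector a b := by
    rw [← cross_anticomm, e1, smul_neg]
  obtain ⟨α, hα, hα'⟩ := exists_cross_eq (f.pair_one a) (f.cross_basis a) hγ hs e1
  obtain ⟨β, hβ, hβ'⟩ := exists_cross_eq (f.pair_one b) (f.cross_basis b) hγ.neg hs e2
  exact ⟨α, β, hα, hβ, hα', hβ', ⟨_, f.pair_one a⟩, ⟨_, f.pair_one b⟩⟩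

lemma Framing.ne_zero (f : Framing) (a : {a : Lattice3 // IsPrimitive a}) :
    (a : Lattice3) ≠ 0 := by
  intro h0
  have := f.pair_one a
  rw [h0] at this
  simp [pair] at this

lemma eventually_codiscrete_Delta_ne_zero (f : Framing) (a : {a : Lattice3 // IsPrimitive a})
    (μ : DualLattice3) {x : Fin 3 → ℂ} (ha : 0 < orientedVolume a x) :
    ∀ᶠ w in Filter.codiscrete ℂ, Delta f a μ w x ≠ 0 := by
  have hτ := im_ev_div_pos (f.cross_basis a) ha
  have h3 := ev_right_ne_zero (f.cross_basis a) ha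
  have h : ∀ s : Finset ℤ, ∀ᶠ w in Filter.codiscrete ℂ, ∀ k ∈ s,
      framedTheta (f.basis a) k w x ≠ 0 := fun s =>
    (Filter.eventually_all_finset s).mpr fun k _ => eventually_codiscrete_theta0_ne_zero hτ _ h3
  filter_upwards [h (Finset.Ico 0 (pair μ a)), h (Finset.Ico (pair μ a) 0)] with w h1 h2
  exact div_ne_zero (Finset.prod_ne_zero_iff.mpr h1) (Finset.prod_ne_zero_iff.mpr h2)

end GammaWedge

end

/-- Off the zeros and poles of the products involved, which form a discrete closed set of `w` for
each `x`, the two sides agree. (A quotient of products is nonzero in Lean exactly when neither its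
numerator nor its denominator vanishes, as `z / 0 = 0`.) -/
theorem mainTheorem11 (f : Framing) (a b : {a : Lattice3 // IsPrimitive a})
    (hab : LinearIndependent ℤ ![(a : Lattice3), (b : Lattice3)]) (μ : DualLattice3) :
    ∃ P : Polynomial RatField, P.degree ≤ 2 ∧ IsHomogeneousZero P ∧
      ∀ x ∈ domain a ∩ domain b,
        (∀ i : ℕ, RegularAt (P.coeff i) x) ∧
        (∀ᶠ w in Filter.codiscrete ℂ, gammaFun a b w x ≠ 0 ∧ gammaFun a b (w + ev μ x) x ≠ 0 ∧
          Delta f a μ w x ≠ 0 ∧ Delta f b μ w x ≠ 0) ∧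
        ∀ w : ℂ, gammaFun a b w x ≠ 0 → gammaFun a b (w + ev μ x) x ≠ 0 →
          Delta f a μ w x ≠ 0 → Delta f b μ w x ≠ 0 →
          gammaFun a b (w + ev μ x) x / gammaFun a b w x =
            Complex.exp (Real.pi * Complex.I * evalPoly P x w) *
              (Delta f a μ w x / Delta f b μ w x) := by
  obtain ⟨α, β, h⟩ := exists_wedgeData f a b hab
  have hD := h.isSection
  have hUa : ∀ x ∈ domain a ∩ domain b, 0 < orientedVolume a x := fun x hx =>
    orientedVolume_pos (f.ne_zero a) hx.1
  have hUb : ∀ x ∈ domain a ∩ domain b, 0 < orientedVolume b x := fun x hx =>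
    orientedVolume_pos (f.ne_zero b) hx.2
  obtain ⟨φ, hφ, hφ'⟩ := exists_exponent_shift h hD (f.pair_one a) (f.cross_basis a) hUa hUb
    (pair μ a) 0
  -- The shift goes from `(0, 0)` to `(μ(a), 0)` and then, through the swapped wedge, to `(μ(a),
  -- μ(b))`; hence `μ(a)` stays fixed in this second part.
  obtain ⟨ψ, hψ, hψ'⟩ := exists_exponent_shift h.swap hD.swap (f.pair_one b) (f.cross_basis b)
    hUb hUa (pair μ b) (pair μ a)
  obtain ⟨P, hdeg, hhom, hP⟩ := (hφ.sub hψ).exists_polynomial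
  refine ⟨P, hdeg, hhom, fun x hx => ⟨(hP x hx).1, ?_, ?_⟩⟩
  · have hΓ : ∀ ν : DualLattice3, ∀ᶠ w in Filter.codiscrete ℂ,
        gammaFun a b (w + ev ν x) x ≠ 0 := fun ν => by
      filter_upwards [eventually_codiscrete_coneProd_ne_zero h (hUa x hx) (hUb x hx) hD
          (pair ν a) (pair ν b),
        eventually_codiscrete_coneProd_ne_zero h.swap (hUb x hx) (hUa x hx) hD.swap
          (pair ν b) (pair ν a)] with w h1 h2
      rw [gammaFun_add_ev h (hUa x hx) (hUb x hx)]
      exact div_ne_zero h1 h2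
    filter_upwards [hΓ 0, hΓ μ, eventually_codiscrete_Delta_ne_zero f a μ (hUa x hx),
      eventually_codiscrete_Delta_ne_zero f b μ (hUb x hx)] with w h1 h2 h3 h4
    have hz : w + ev 0 x = w := by simp [ev]
    rw [hz] at h1
    exact ⟨h1, h2, h3, h4⟩
  · intro w h1 _ h3 h4
    have hz : gammaFun a b w x = coneRatio a b (directionVector a b)
        (representative (directionVector a b)) 0 0 w x := by
      have := gammaFun_add_ev h (hUa x hx) (hUb x hx) 0 w
      simpa [ev, pair] using this
    have e1 := hφ' x hx w h3
    have e2 := hψ' x hx w h4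
    -- The swapped ratios are the inverses of the original ones, which puts `Δ_b` in the denominator
    -- and `ψ` with a minus sign.
    rw [coneRatio_swap, coneRatio_swap] at e2
    rw [hz] at h1 ⊢
    rw [gammaFun_add_ev h (hUa x hx) (hUb x hx), (hP x hx).2 w]
    change _ = Complex.exp (Real.pi * Complex.I * φ x w) * Delta f a μ w x * _ at e1
    change _ = Complex.exp (Real.pi * Complex.I * ψ x w) * Delta f b μ w x * _ at e2
    have e3 := congrArg (fun z : ℂ => z⁻¹) e2
    simp only [inv_inv, mul_inv] at e3
    rw [e3, e1, mul_sub, Complex.exp_sub]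
    have := Complex.exp_ne_zero (Real.pi * Complex.I * ψ x w)
    field_simp
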